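/- Let $M$ be a connected, compact, smooth Riemannian manifold without boundary, of dimension $n\ge 1$, with Riemannian distance $d$; write $B(x,r)$ for the closed ball. Let $0<\theta\le 1$ and let $f:M\to M$ be a $C^{1+\theta}$ map ($f$ is $C^1$ and in local charts its derivative is locally $\theta$-Hölder) which is expanding, i.e. there are $c>0$ and $\sigma>1$ with $\|D_x(f^k)v\|\ge c\,\sigma^k\|v\|$ for all $k\ge 0$, $x\in M$, $v\in T_xM$, and conformal, i.e. for each $x\in M$ the derivative $D_xf:T_xM\to T_{f(x)}M$ is a scalar multiple of a linear isometry. Let $y\in M$ and $$E(f,y)=\{z\in M:\ y\notin\overline{\{f^k(z):k\ge 0\}}\}.$$ Then: (1) $E(f,y)$ is ($0$-dimensionally) absolute winning, i.e. for every $0<\beta<1/3$ Alice has a winning strategy in the following game with target set $S=E(f,y)$. Bob chooses $x_1\in M$, $\rho_1>0$. After Bob has chosen $B_i=B(x_i,\rho_i)$, Alice chooses $p_i\in M$ and $0<\epsilon_i\le\beta\rho_i$, and Bob then chooses a ball $B_{i+1}=B(x_{i+1},\rho_{i+1})\subset B_i\setminus\{z:d(z,p_i)<\epsilon_i\}$ with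 $\rho_{i+1}\ge\beta\rho_i$. If Bob ever has no legal move, he loses; otherwise Alice wins if and only if $\bigcap_i B_i\cap S\ne\emptyset$. (2) In particular, $E(f,y)$ is $1/2$-winning for Schmidt's game on $M$, i.e. with $\alpha=1/2$ and for every $0<\beta<1$ Alice has a winning strategy in the following game with target set $S=E(f,y)$. Bob chooses $x_1\in M$, $r_1>0$; in turn $i$ Alice chooses $x_i'$ with $B(x_i',r_i')\subset B(x_i,r_i)$, $r_i'=\alpha r_i$, and Bob then chooses $x_{i+1}$ with $B(x_{i+1},r_{i+1})\subset B(x_i',r_i')$, $r_{i+1}=\beta r_i'$. Alice wins if and only if the unique point of $\bigcap_i B(x_i,r_i)$ lies in $S$. -/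

import Mathlib

open Set Metric Topology Manifold Bundle
open scoped NNReal ContDiff

/-! ### Infinite two-player games: strategies of the second player (Alice) -/

/-- A (deterministic, full-information) strategy for Alice when Bob's moves have type `P` and
Alice's moves have type `Q`: in turn `i` she answers to the list of all moves `0, …, i` that Bob
has made so far (her own earlier moves are determined by these). -/
abbrev AliceStrategy (P Q : Type*) := (i : ℕ) → (Fin (i + 1) → P) → Q

/-- Alice's move in turn `i` if she follows the strategy `s` and Bob's moves are `b 0, b 1, …`. -/
def AliceStrategy.move {P Q : Type*} (s : AliceStrategy P Q) (b : ℕ → P) (i : ℕ) : Q :=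
  s i (fun j => b j)

section Games

variable {X : Type*} [MetricSpace X]

/-- The closed ball `B(p)` given by a pair `p = (x, r)`. -/
def gameBall (p : X × ℝ) : Set X := closedBall p.1 p.2

/-! ### Schmidt's game -/

/-- Bob's move `b i` is legal in Schmidt's `(α, β)`-game, given that Alice plays `a 0, a 1, …`:
the first move is any pair of positive radius, and
`B(b (i+1)) ⊆ B(a i)`, `radius (b (i+1)) = β * radius (a i)`. -/
def SchmidtBobLegal (β : ℝ) (a b : ℕ → X × ℝ) : ℕ → Prop
  | 0 => 0 < (b 0).2
  | i + 1 => gameBall (b (i + 1)) ⊆ gameBall (a i) ∧ (b (i + 1)).2 = β * (a i).2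

/-- Alice's move `a i` is legal in Schmidt's `(α, β)`-game. -/
def SchmidtAliceLegal (α : ℝ) (a b : ℕ → X × ℝ) (i : ℕ) : Prop :=
  gameBall (a i) ⊆ gameBall (b i) ∧ (a i).2 = α * (b i).2

/-- `S` is `(α, β)`-winning: Alice has a strategy that always tells her a legal move as long as
Bob has played legally, and such that in every infinite run the balls meet in exactly one point,
which belongs to `S`. -/
def IsSchmidtWinningWith (α β : ℝ) (S : Set X) : Prop :=
  ∃ s : AliceStrategy (X × ℝ) (X × ℝ), ∀ b : ℕ → X × ℝ,
    (∀ i, (∀ j ≤ i, SchmidtBobLegal β (s.move b) b j) → SchmidtAliceLegal α (s.move b) b i) ∧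
    ((∀ i, SchmidtBobLegal β (s.move b) b i) → ∃ x ∈ S, ⋂ i, gameBall (b i) = {x})

/-- `S` is `α`-winning for Schmidt's game: it is `(α, β)`-winning for every `0 < β < 1`. -/
def IsSchmidtWinning (α : ℝ) (S : Set X) : Prop :=
  ∀ β : ℝ, 0 < β → β < 1 → IsSchmidtWinningWith α β S

/-! ### The (0-dimensional) absolute game -/

/-- Bob's move `b i` is legal in the `β`-absolute game, given that Alice plays `a 0, a 1, …`, where
`a i = (p, ε)` means that she removes the `ε`-neighbourhood of the point `p`: the first move is any
pair of positive radius, and `B(b (i+1)) ⊆ B(b i) \ {z | d(z, p) < ε}`,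
`radius (b (i+1)) ≥ β * radius (b i)`. -/
def AbsoluteBobLegal (β : ℝ) (a b : ℕ → X × ℝ) : ℕ → Prop
  | 0 => 0 < (b 0).2
  | i + 1 => gameBall (b (i + 1)) ⊆ gameBall (b i) \ ball (a i).1 (a i).2 ∧
      β * (b i).2 ≤ (b (i + 1)).2

/-- Alice's move `a i = (p, ε)` is legal in the `β`-absolute game:
`0 < ε ≤ β * radius (b i)`. -/
def AbsoluteAliceLegal (β : ℝ) (a b : ℕ → X × ℝ) (i : ℕ) : Prop :=
  0 < (a i).2 ∧ (a i).2 ≤ β * (b i).2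

/-- `S` is `β`-absolute winning: Alice has a strategy that always tells her a legal move as long as
Bob has played legally, and such that in every infinite run the intersection of Bob's balls
contains a point of `S`. (In a compact manifold Bob may be left without a legal move, but only if
his ball is large compared with the manifold; he then loses.) -/
def IsAbsoluteWinningWith (β : ℝ) (S : Set X) : Prop :=
  ∃ s : AliceStrategy (X × ℝ) (X × ℝ), ∀ b : ℕ → X × ℝ,
    (∀ i, (∀ j ≤ i, AbsoluteBobLegal β (s.move b) b j) → AbsoluteAliceLegal β (s.move b) b i) ∧
    ((∀ i, AbsoluteBobLegal β (s.move b) b i) → ((⋂ i, gameBall (b i)) ∩ S).Nonempty)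

/-- `S` is (0-dimensionally) absolute winning: `β`-absolute winning for every `0 < β < 1/3`. -/
def IsAbsoluteWinning (S : Set X) : Prop :=
  ∀ β : ℝ, 0 < β → β < 1 / 3 → IsAbsoluteWinningWith β S

end Games

/-! ### Dynamics -/

/-- `E(f, y)`: the points `z` such that `y` is not in the closure of the forward orbit
`{z, f z, f (f z), …}`. -/
def nonAccumulationSet {X : Type*} [TopologicalSpace X] (f : X → X) (y : X) : Set X :=
  {z | y ∉ closure (range fun k : ℕ => f^[k] z)}

section Manifold

variable {n : ℕ} {M : Type*} [TopologicalSpace M] [ChartedSpace (EuclideanSpace ℝ (Fin n)) M]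

/-- `f` is of class `C^{1+θ}`: it is `C^1`, and in local charts its derivative is locally
`θ`-Hölder. -/
def IsC1Holder (θ : ℝ≥0) (f : M → M) : Prop :=
  ContMDiff (𝓡 n) (𝓡 n) 1 f ∧
    ∀ x : M, ∃ C : ℝ≥0, ∃ U ∈ 𝓝 (extChartAt (𝓡 n) x x),
      HolderOnWith C θ (fderiv ℝ (writtenInExtChartAt (𝓡 n) (𝓡 n) x f)) U

variable [IsManifold (𝓡 n) 1 M] [RiemannianBundle (fun x : M => TangentSpace (𝓡 n) x)]

/-- `f` is expanding: there are `c > 0` and `σ > 1` such that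
`‖D_x(f^k) v‖ ≥ c σ^k ‖v‖` for all `k ≥ 0` and all tangent vectors `v`. -/
def IsExpanding (f : M → M) : Prop :=
  ∃ c : ℝ, 0 < c ∧ ∃ σ : ℝ, 1 < σ ∧ ∀ (k : ℕ) (x : M) (v : TangentSpace (𝓡 n) x),
    c * σ ^ k * ‖v‖ ≤ ‖mfderiv (𝓡 n) (𝓡 n) (f^[k]) x v‖

/-- `f` is conformal: each derivative `D_x f : T_x M → T_{f x} M` is a scalar multiple of a linear
isometry. -/
def IsConformalEndo (f : M → M) : Prop :=
  ∀ x : M, ∃ (a : ℝ) (L : TangentSpace (𝓡 n) x →ₗᵢ[ℝ] TangentSpace (𝓡 n) (f x)),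
    ∀ v : TangentSpace (𝓡 n) x, mfderiv (𝓡 n) (𝓡 n) f x v = a • L v

end Manifold

/-! The set to stay away from consists of the iterated preimages of `y`. Conformality and the Hölder
condition give, uniformly on the compact manifold, |d(f u, f v) - a(u) d(u, v)| ≤ C d(u, v)^(1+θ),
where a(u) is the norm of the derivative at u (`exists_local_similarity_estimate`). Because f
expands, the relative errors along an orbit are dominated by a geometric series, so f^k is a
similarity up to a factor D as long as the image stays small (`exists_bounded_distortion`).

Let F_k be the conformal factor of f^k, and fix a window [η', η]. In a ball of centre x and radius
r, any two times k with F_k(x) r in the window differ by less than a constant N. Along balls that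
shrink to a point with bounded ratio, every k enters the window in some turn. In one ball, all
points that come ε-close to `y` at a time in the window lie within βr of each other: if p does so at
time k and p' at time k + j, then f^j y is close to y, hence equal to y since j < N leaves finitely
many cases, so p and p' are both mapped near y by f^(k+j), and bounded distortion pulls this back.
Deleting one ball of radius βr therefore removes every dangerous point of that turn
(`exists_escaping_choice`).

The games use this only through `HasEscapingChoice`, together with the geometric fact
`AlmostExtendsSegments`, which gives room to move away from a point. In the absolute game Alice
deletes the chosen ball, and density of the target settles the runs whose radii do not tend to 0. In
Schmidt's game with α = 1/2, two turns simulate one deletion (`AlmostExtendsSegments.exists_avoid`).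
-/

/-! ### Bounded distortion for expanding maps that are conformal in the metric sense -/

section Distortion

/-- The conformal factor of the `k`-th iterate of `f`, if `a` is the conformal factor of `f`. -/
noncomputable def iterFactor {X : Type*} (f : X → X) (a : X → ℝ) (k : ℕ) (u : X) : ℝ :=
  ∏ j ∈ Finset.range k, a (f^[j] u)

@[simp] lemma iterFactor_zero {X : Type*} (f : X → X) (a : X → ℝ) (u : X) : iterFactor f a 0 u = 1 := by
  simp [iterFactor]

lemma iterFactor_succ {X : Type*} (f : X → X) (a : X → ℝ) (k : ℕ) (u : X) :
    iterFactor f a (k + 1) u = iterFactor f a k u * a (f^[k] u) := by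
  simp [iterFactor, Finset.prod_range_succ]

lemma iterFactor_add {X : Type*} (f : X → X) (a : X → ℝ) (j k : ℕ) (u : X) :
    iterFactor f a (j + k) u = iterFactor f a j u * iterFactor f a k (f^[j] u) := by
  simp only [iterFactor, Finset.prod_range_add]
  congr 1
  refine Finset.prod_congr rfl fun i _ => ?_
  rw [← Function.iterate_add_apply, add_comm]

variable {X : Type*} [MetricSpace X]

lemma Real.exp_neg_two_mul_le {x : ℝ} (h0 : 0 ≤ x) (h : x ≤ 1 / 2) :
    Real.exp (-(2 * x)) ≤ 1 - x := by
  rw [Real.exp_neg]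
  have h1 : 2 * x + 1 ≤ Real.exp (2 * x) := Real.add_one_le_exp _
  rw [inv_le_comm₀ (Real.exp_pos _) (by linarith)]
  refine le_trans ?_ h1
  rw [inv_le_iff_one_le_mul₀ (by linarith)]
  nlinarith

/-- Since a is bounded below, the additive error is a relative error of order d^θ. Writing it as an
exponential turns composition along an orbit into addition of exponents. The lower bound needs 1 - x
≥ exp(-2x), hence the restriction to x ≤ 1/2. -/
lemma exists_exp_bounds {f : X → X} {a : X → ℝ} {a₀ θ C r : ℝ} (ha₀ : 0 < a₀) (ha : ∀ u, a₀ ≤ a u)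
    (hθ : 0 < θ) (hr : 0 < r)
    (h : ∀ u v, dist u v ≤ r →
      |dist (f u) (f v) - a u * dist u v| ≤ C * dist u v ^ (1 + θ)) :
    ∃ K : ℝ, 0 ≤ K ∧ ∃ r' : ℝ, 0 < r' ∧ ∀ u v, dist u v ≤ r' →
      a u * dist u v * Real.exp (-(K * dist u v ^ θ)) ≤ dist (f u) (f v) ∧
      dist (f u) (f v) ≤ a u * dist u v * Real.exp (K * dist u v ^ θ) := by
  set B : ℝ := (|C| + 1) / a₀ with hB
  have hB0 : 0 < B := by positivity
  refine ⟨2 * B, by positivity, min r ((1 / (2 * B)) ^ (1 / θ)), by positivity, fun u v huv => ?_⟩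
  have h1 := h u v (huv.trans (min_le_left _ _))
  have h2 : B * dist u v ^ θ ≤ 1 / 2 := by
    have : dist u v ^ θ ≤ ((1 / (2 * B)) ^ (1 / θ)) ^ θ :=
      Real.rpow_le_rpow dist_nonneg (huv.trans (min_le_right _ _)) hθ.le
    rw [← Real.rpow_mul (by positivity), one_div_mul_cancel hθ.ne', Real.rpow_one] at this
    calc B * dist u v ^ θ ≤ B * (1 / (2 * B)) := by gcongr
      _ = 1 / 2 := by field_simp
  have hd : 0 ≤ dist u v := dist_nonneg
  rw [Real.rpow_add_of_nonneg hd zero_le_one hθ.le, Real.rpow_one] at h1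
  set x := B * dist u v ^ θ with hx
  have hx0 : 0 ≤ x := by positivity
  have h3 : C * (dist u v * dist u v ^ θ) ≤ a u * dist u v * x := by
    have h4 : C ≤ a u * B := by
      calc C ≤ |C| + 1 := by linarith [le_abs_self C]
        _ = a₀ * B := by rw [hB]; field_simp
        _ ≤ a u * B := by gcongr; exact ha u
    calc C * (dist u v * dist u v ^ θ) ≤ a u * B * (dist u v * dist u v ^ θ) := by gcongr
      _ = a u * dist u v * x := by rw [hx]; ring
  have had : 0 ≤ a u * dist u v := mul_nonneg (ha₀.le.trans (ha u)) hd
  rw [abs_le] at h1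
  rw [show 2 * B * dist u v ^ θ = 2 * x by rw [hx]; ring]
  constructor
  · calc _ ≤ a u * dist u v * (1 - x) := by gcongr; exact Real.exp_neg_two_mul_le hx0 h2
      _ ≤ _ := by linarith
  · calc _ ≤ a u * dist u v * (1 + x) := by linarith
      _ ≤ _ := by
        gcongr
        linarith [Real.add_one_le_exp (2 * x)]

/-- The errors multiply along the orbit. The factors at u and v are compared without any regularity
of a: the one-step estimate is read from u and from v, and the common distance, which is positive,
cancels. -/
lemma iterate_exp_bounds {f : X → X} {a : X → ℝ} {θ K r : ℝ} (ha : ∀ u, 0 < a u)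
    (h : ∀ u v, dist u v ≤ r →
      a u * dist u v * Real.exp (-(K * dist u v ^ θ)) ≤ dist (f u) (f v) ∧
      dist (f u) (f v) ≤ a u * dist u v * Real.exp (K * dist u v ^ θ))
    {u v : X} (huv : u ≠ v) {k : ℕ} (hk : ∀ j < k, dist (f^[j] u) (f^[j] v) ≤ r) :
    0 < dist (f^[k] u) (f^[k] v) ∧
    iterFactor f a k u * dist u v *
        Real.exp (-(K * ∑ j ∈ Finset.range k, dist (f^[j] u) (f^[j] v) ^ θ)) ≤
      dist (f^[k] u) (f^[k] v) ∧
    dist (f^[k] u) (f^[k] v) ≤ iterFactor f a k u * dist u v *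
        Real.exp (K * ∑ j ∈ Finset.range k, dist (f^[j] u) (f^[j] v) ^ θ) ∧
    iterFactor f a k v ≤ iterFactor f a k u *
        Real.exp (2 * (K * ∑ j ∈ Finset.range k, dist (f^[j] u) (f^[j] v) ^ θ)) := by
  induction k with
  | zero => simpa using huv
  | succ k ih =>
    obtain ⟨h0, h1, h2, h3⟩ := ih fun j hj => hk j (hj.trans k.lt_succ_self)
    set S := ∑ j ∈ Finset.range k, dist (f^[j] u) (f^[j] v) ^ θ
    have hd := hk k k.lt_succ_self
    obtain ⟨h4, h5⟩ := h _ _ hd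
    obtain ⟨h6, h7⟩ := h (f^[k] v) (f^[k] u) (by rwa [dist_comm])
    rw [dist_comm (f^[k] v), dist_comm (f (f^[k] v))] at h6 h7
    simp only [Finset.sum_range_succ, iterFactor_succ, Function.iterate_succ_apply']
    set d := dist (f^[k] u) (f^[k] v)
    set au := a (f^[k] u)
    set av := a (f^[k] v)
    have hau : 0 < au := ha _
    have hav : 0 < av := ha _
    have hpos : 0 < iterFactor f a k u := Finset.prod_pos fun j _ => ha _
    have hv : av ≤ au * Real.exp (2 * (K * d ^ θ)) := by
      have h8 := h6.trans h5
      rw [Real.exp_neg, ← div_eq_mul_inv, div_le_iff₀ (Real.exp_pos _)] at h8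
      have : av * d ≤ au * Real.exp (2 * (K * d ^ θ)) * d := by
        calc av * d ≤ _ := h8
          _ = _ := by rw [two_mul, Real.exp_add]; ring
      exact le_of_mul_le_mul_right this h0
    refine ⟨lt_of_lt_of_le (by positivity) h4, ?_, ?_, ?_⟩
    · calc _ = au * (iterFactor f a k u * dist u v * Real.exp (-(K * S))) *
            Real.exp (-(K * d ^ θ)) := by
            rw [mul_add, neg_add, Real.exp_add]; ring
        _ ≤ au * d * Real.exp (-(K * d ^ θ)) := by gcongr
        _ ≤ _ := h4
    · calc _ ≤ au * d * Real.exp (K * d ^ θ) := h5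
        _ ≤ au * (iterFactor f a k u * dist u v * Real.exp (K * S)) * Real.exp (K * d ^ θ) := by
            gcongr
        _ = _ := by rw [mul_add, Real.exp_add]; ring
    · calc _ ≤ (iterFactor f a k u * Real.exp (2 * (K * S))) *
            (au * Real.exp (2 * (K * d ^ θ))) := by gcongr
        _ = _ := by rw [mul_add, mul_add, Real.exp_add]; ring

/-- Distortion estimates for the iterates of an expanding map that is conformal in the metric
sense: as long as the image is small, `f^[k]` is close to a similarity. -/
theorem exists_bounded_distortion {f : X → X} {a : X → ℝ} {c σ θ C r : ℝ} (hc : 0 < c)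
    (hσ : 1 < σ) (ha : ∀ u, 0 < a u) (hexp : ∀ k u, c * σ ^ k ≤ iterFactor f a k u)
    (hθ : 0 < θ) (hr : 0 < r)
    (h : ∀ u v, dist u v ≤ r →
      |dist (f u) (f v) - a u * dist u v| ≤ C * dist u v ^ (1 + θ)) :
    ∃ κ : ℝ, 0 < κ ∧ ∃ D : ℝ, 1 ≤ D ∧ ∀ (u v : X) (k : ℕ),
      iterFactor f a k u * dist u v ≤ κ →
        iterFactor f a k u * dist u v ≤ D * dist (f^[k] u) (f^[k] v) ∧
        dist (f^[k] u) (f^[k] v) ≤ D * (iterFactor f a k u * dist u v) ∧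
        iterFactor f a k v ≤ D * iterFactor f a k u := by
  have ha₀ : ∀ u, c * σ ≤ a u := fun u => by simpa [iterFactor] using hexp 1 u
  have hc1 : ∀ k u, c ≤ iterFactor f a k u := fun k u =>
    le_trans (le_mul_of_one_le_right hc.le (one_le_pow₀ hσ.le)) (hexp k u)
  obtain ⟨K, hK, r₁, hr₁, h⟩ := exists_exp_bounds (by positivity) ha₀ hθ hr h
  -- Below scale r₂ one step loses at most a factor σ^(-1/2), so a net expansion by σ^(1/2) = τ⁻¹
  -- per step remains.
  obtain ⟨r₂, hr₂, hr₂₁, hKr⟩ : ∃ r₂ : ℝ, 0 < r₂ ∧ r₂ ≤ r₁ ∧ K * r₂ ^ θ ≤ Real.log σ / 2 := by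
    have hl : 0 < Real.log σ := Real.log_pos hσ
    refine ⟨min r₁ ((Real.log σ / (2 * (K + 1))) ^ (1 / θ)), by positivity, min_le_left _ _, ?_⟩
    calc _ ≤ K * ((Real.log σ / (2 * (K + 1))) ^ (1 / θ)) ^ θ := by
          gcongr; exact min_le_right _ _
      _ ≤ (K + 1) * (Real.log σ / (2 * (K + 1))) := by
          rw [← Real.rpow_mul (by positivity), one_div_mul_cancel hθ.ne', Real.rpow_one]
          gcongr; linarith
      _ = _ := by field_simp
  set τ : ℝ := Real.exp (-(Real.log σ / 2)) with hτ
  have hτ0 : 0 < τ := Real.exp_pos _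
  have hτ1 : τ < 1 := by
    rw [hτ, Real.exp_lt_one_iff]
    linarith [Real.log_pos hσ]
  have hστ : σ * τ = τ⁻¹ := by
    rw [hτ, ← Real.exp_neg, neg_neg]
    nth_rewrite 1 [← Real.exp_log (zero_lt_one.trans hσ)]
    rw [← Real.exp_add]
    congr 1
    ring
  have h' : ∀ u v, dist u v ≤ r₂ →
      a u * dist u v * Real.exp (-(K * dist u v ^ θ)) ≤ dist (f u) (f v) ∧
      dist (f u) (f v) ≤ a u * dist u v * Real.exp (K * dist u v ^ θ) :=
    fun u v huv => h u v (huv.trans hr₂₁)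
  -- backward contraction
  have hback : ∀ (u v : X), u ≠ v → ∀ k : ℕ, (∀ j < k, dist (f^[j] u) (f^[j] v) ≤ r₂) →
      c * dist u v ≤ τ ^ k * dist (f^[k] u) (f^[k] v) := by
    intro u v huv k hk
    obtain ⟨-, h1, -, -⟩ := iterate_exp_bounds ha h' huv hk
    have h2 : τ ^ k ≤ Real.exp (-(K * ∑ j ∈ Finset.range k, dist (f^[j] u) (f^[j] v) ^ θ)) := by
      rw [hτ, ← Real.exp_nat_mul, Real.exp_le_exp, mul_neg, neg_le_neg_iff, Finset.mul_sum]
      calc _ ≤ ∑ j ∈ Finset.range k, Real.log σ / 2 := by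
            refine Finset.sum_le_sum fun j hj => le_trans ?_ hKr
            gcongr
            exact hk j (Finset.mem_range.1 hj)
        _ = _ := by simp
    have h3 : c * σ ^ k * dist u v * τ ^ k ≤ dist (f^[k] u) (f^[k] v) := by
      refine le_trans ?_ h1
      gcongr
      · exact mul_nonneg (hc.le.trans (hc1 k u)) dist_nonneg
      · exact hexp k u
    calc c * dist u v = τ ^ k * (c * σ ^ k * dist u v * τ ^ k) := by
          have : (σ * τ) ^ k * τ ^ k = 1 := by
            rw [hστ, ← mul_pow, inv_mul_cancel₀ hτ0.ne', one_pow]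
          rw [mul_pow] at this
          linear_combination (-c * dist u v) * this
      _ ≤ _ := by gcongr
  have hτθ : τ ^ θ < 1 := Real.rpow_lt_one hτ0.le hτ1 hθ
  set S : ℝ := (r₂ / c) ^ θ * (1 - τ ^ θ)⁻¹ with hS
  have hS0 : 0 ≤ S := mul_nonneg (by positivity) (inv_nonneg.2 (by linarith))
  have hsum : ∀ (u v : X), u ≠ v → ∀ k : ℕ, (∀ j < k, dist (f^[j] u) (f^[j] v) ≤ r₂) →
      ∑ j ∈ Finset.range k, dist (f^[j] u) (f^[j] v) ^ θ ≤ S := by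
    intro u v huv k hk
    -- Backward contraction is counted from time k - 1, the last time at which the distance is known
    -- to be at most r₂.
    have hterm : ∀ j ∈ Finset.range k,
        dist (f^[j] u) (f^[j] v) ^ θ ≤ (r₂ / c) ^ θ * (τ ^ θ) ^ (k - 1 - j) := by
      intro j hj
      rw [Finset.mem_range] at hj
      have hne : f^[j] u ≠ f^[j] v := by
        have := (iterate_exp_bounds ha h' huv fun i hi => hk i (hi.trans hj)).1
        exact dist_pos.1 this
      have h1 := hback _ _ hne (k - 1 - j) fun i hi => by
        rw [← Function.iterate_add_apply, ← Function.iterate_add_apply]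
        exact hk _ (by omega)
      rw [← Function.iterate_add_apply, ← Function.iterate_add_apply,
        show k - 1 - j + j = k - 1 by omega] at h1
      have h2 : dist (f^[j] u) (f^[j] v) ≤ r₂ / c * τ ^ (k - 1 - j) := by
        rw [div_mul_eq_mul_div, le_div_iff₀ hc, mul_comm, mul_comm r₂]
        refine h1.trans ?_
        gcongr
        exact hk _ (by omega)
      calc _ ≤ (r₂ / c * τ ^ (k - 1 - j)) ^ θ := by gcongr
        _ = _ := by
          rw [Real.mul_rpow (by positivity) (by positivity), ← Real.rpow_natCast,
            ← Real.rpow_natCast, ← Real.rpow_mul hτ0.le, ← Real.rpow_mul hτ0.le, mul_comm θ]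
    refine (Finset.sum_le_sum hterm).trans ?_
    rw [← Finset.mul_sum, Finset.sum_range_reflect (fun j => (τ ^ θ) ^ j) k, hS]
    gcongr
    rw [← tsum_geometric_of_lt_one (by positivity) hτθ]
    exact (summable_geometric_of_lt_one (by positivity) hτθ).sum_le_tsum _
      fun j _ => by positivity
  set D : ℝ := Real.exp (2 * (K * S)) with hD
  have hKS : 0 ≤ K * S := mul_nonneg hK hS0
  have hD1 : 1 ≤ D := Real.one_le_exp (by linarith)
  have hmain : ∀ (u v : X), u ≠ v → ∀ k : ℕ, (∀ j < k, dist (f^[j] u) (f^[j] v) ≤ r₂) →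
      iterFactor f a k u * dist u v ≤ D * dist (f^[k] u) (f^[k] v) ∧
        dist (f^[k] u) (f^[k] v) ≤ D * (iterFactor f a k u * dist u v) ∧
        iterFactor f a k v ≤ D * iterFactor f a k u := by
    intro u v huv k hk
    obtain ⟨-, h1, h2, h3⟩ := iterate_exp_bounds ha h' huv hk
    have hs := hsum u v huv k hk
    have hP : 0 ≤ iterFactor f a k u := hc.le.trans (hc1 k u)
    have hPd : 0 ≤ iterFactor f a k u * dist u v := mul_nonneg hP dist_nonneg
    set T := ∑ j ∈ Finset.range k, dist (f^[j] u) (f^[j] v) ^ θ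
    have hKT : K * T ≤ K * S := by gcongr
    have hT : Real.exp (2 * (K * T)) ≤ D := Real.exp_le_exp.2 (by linarith)
    have hT' : Real.exp (K * T) ≤ D := Real.exp_le_exp.2 (by linarith)
    refine ⟨?_, ?_, ?_⟩
    · rw [Real.exp_neg, ← div_eq_mul_inv, div_le_iff₀ (Real.exp_pos _)] at h1
      rw [mul_comm D]
      refine h1.trans ?_
      gcongr
    · refine h2.trans ?_
      rw [mul_comm D]
      gcongr
    · refine h3.trans ?_
      rw [mul_comm D]
      gcongr
  -- With this κ, induction on j keeps all times j < k below r₂: F_j ≤ F_k / c, so the distance at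
  -- time j is at most D κ / c = r₂.
  refine ⟨c * r₂ / D, by positivity, D, hD1, fun u v k huk => ?_⟩
  rcases eq_or_ne u v with rfl | huv
  · simpa using le_mul_of_one_le_left (hc.le.trans (hc1 k u)) hD1
  refine hmain u v huv k fun j => ?_
  induction j using Nat.strong_induction_on with
  | _ j ih =>
    intro hj
    have h1 := (hmain u v huv j fun i hi => ih i hi (hi.trans hj)).2.1
    have h2 : iterFactor f a j u * dist u v * c ≤ iterFactor f a k u * dist u v := by
      have : iterFactor f a k u = iterFactor f a j u * iterFactor f a (k - j) (f^[j] u) := by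
        rw [← iterFactor_add, Nat.add_sub_cancel' hj.le]
      rw [this]
      have hp : 0 ≤ iterFactor f a j u := hc.le.trans (hc1 j u)
      calc _ = iterFactor f a j u * c * dist u v := by ring
        _ ≤ _ := by gcongr; exact hc1 _ _
    have h3 : iterFactor f a j u * dist u v * c ≤ c * r₂ / D := h2.trans huk
    rw [le_div_iff₀ (by linarith)] at h3
    refine h1.trans ?_
    have : c * (D * (iterFactor f a j u * dist u v)) ≤ c * r₂ := by linarith
    exact le_of_mul_le_mul_left this hc

end Distortion

/-! ### Escaping the preimages of a point -/

section Escape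

variable {X : Type*} [MetricSpace X]

lemma mem_nonAccumulationSet_of_forall_le_dist {f : X → X} {y z : X} {ε : ℝ} (hε : 0 < ε)
    (h : ∀ k : ℕ, ε ≤ dist (f^[k] z) y) : z ∈ nonAccumulationSet f y := by
  intro hy
  obtain ⟨-, ⟨k, rfl⟩, hk⟩ := Metric.mem_closure_iff.1 hy ε hε
  rw [dist_comm] at hk
  exact absurd hk (h k).not_gt

/-- For all `j < N`, either `f^[j] y = y` or `f^[j] y` is far from `y`. -/
lemma exists_gap_iterate (f : X → X) (y : X) (N : ℕ) :
    ∃ δ : ℝ, 0 < δ ∧ ∀ j < N, dist (f^[j] y) y < δ → f^[j] y = y := by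
  induction N with
  | zero => exact ⟨1, one_pos, by simp⟩
  | succ N ih =>
    obtain ⟨δ, hδ, h⟩ := ih
    by_cases hN : f^[N] y = y
    · refine ⟨δ, hδ, fun j hj hd => ?_⟩
      rcases Nat.lt_succ_iff_lt_or_eq.1 hj with hj | rfl
      exacts [h j hj hd, hN]
    · refine ⟨min δ (dist (f^[N] y) y), lt_min hδ (dist_pos.2 hN), fun j hj hd => ?_⟩
      rcases Nat.lt_succ_iff_lt_or_eq.1 hj with hj | rfl
      · exact h j hj (hd.trans_le (min_le_left _ _))
      · exact absurd (min_le_right _ _) hd.not_ge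

lemma exists_forall_lt_dist_iterate_lt {f : X → X} (hf : Continuous f) (y : X) (N : ℕ) {e : ℝ}
    (he : 0 < e) :
    ∃ ε : ℝ, 0 < ε ∧ ∀ j < N, ∀ q, dist q y < ε → dist (f^[j] q) (f^[j] y) < e := by
  have : ∀ᶠ q in 𝓝 y, ∀ j < N, dist (f^[j] q) (f^[j] y) < e := by
    refine (Filter.eventually_all_finite (Set.finite_lt_nat N)).2 ?_
    exact fun j _ => (hf.iterate j).continuousAt.eventually (ball_mem_nhds _ he)
  obtain ⟨ε, hε, h⟩ := Metric.eventually_nhds_iff.1 this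
  exact ⟨ε, hε, fun j hj q hq => h hq j hj⟩

/-- Alice's answer in one turn: there is a choice of a point in each ball such that every sequence
of balls with radii not bounded below that avoids the chosen points shrinks to a point of
`nonAccumulationSet f y`. -/
theorem exists_escaping_choice {f : X → X} (hf : Continuous f) {a : X → ℝ} {c σ κ D : ℝ}
    (hc : 0 < c) (hσ : 1 < σ) (hexp : ∀ k u, c * σ ^ k ≤ iterFactor f a k u)
    (hκ : 0 < κ) (hD : 1 ≤ D)
    (h : ∀ (u v : X) (k : ℕ), iterFactor f a k u * dist u v ≤ κ →
        iterFactor f a k u * dist u v ≤ D * dist (f^[k] u) (f^[k] v) ∧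
        dist (f^[k] u) (f^[k] v) ≤ D * (iterFactor f a k u * dist u v) ∧
        iterFactor f a k v ≤ D * iterFactor f a k u)
    (y : X) {β ρ : ℝ} (hβ : 0 < β) (hβ1 : β ≤ 1) (hρ : 0 < ρ) :
    ∃ P : X × ℝ → X, ∀ b : ℕ → X × ℝ, ρ ≤ (b 0).2 → (∀ i, 0 < (b i).2) →
      (∀ i, β * (b i).2 ≤ (b (i + 1)).2) → (∀ i, (b (i + 1)).1 ∈ gameBall (b i)) →
      (∀ ε > 0, ∃ i, (b i).2 < ε) →
      ∀ z, (∀ i, z ∈ gameBall (b i)) → (∀ i, z ∉ ball (P (b i)) (β * (b i).2)) →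
      z ∈ nonAccumulationSet f y := by
  have hD0 : 0 < D := by linarith
  have hF : ∀ k u, 0 < iterFactor f a k u := fun k u =>
    lt_of_lt_of_le (by positivity) (hexp k u)
  have hFc : ∀ k u, c ≤ iterFactor f a k u := fun k u =>
    le_trans (le_mul_of_one_le_right hc.le (one_le_pow₀ hσ.le)) (hexp k u)
  -- Two active times have factors with ratio at most η / η' = D / β, while j further steps gain at
  -- least c σ^j. Thus c σ^N > D / β bounds their difference by N.
  obtain ⟨N, hN⟩ := pow_unbounded_of_one_lt (D / (β * c)) hσ
  rw [div_lt_iff₀ (by positivity)] at hN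
  obtain ⟨δ, hδ, hgap⟩ := exists_gap_iterate f y N
  -- `k` is active in `B(x, r)` if `η' ≤ iterFactor f a k x * r ≤ η`
  obtain ⟨η, hη, h1, h2, h3, h4⟩ : ∃ η : ℝ, 0 < η ∧ 2 * D * η ≤ κ ∧ 2 * D ^ 2 * η ≤ δ / 2 ∧
      η ≤ β * κ ∧ η ≤ c * ρ := by
    refine ⟨min (min (κ / (2 * D)) (δ / 2 / (2 * D ^ 2))) (min (β * κ) (c * ρ)),
      by positivity, ?_, ?_, ?_, ?_⟩
    · rw [← le_div_iff₀' (by positivity)]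
      exact (min_le_left _ _).trans (min_le_left _ _)
    · rw [← le_div_iff₀' (by positivity)]
      exact (min_le_left _ _).trans (min_le_right _ _)
    · exact (min_le_right _ _).trans (min_le_left _ _)
    · exact (min_le_right _ _).trans (min_le_right _ _)
  -- In one turn the radius drops by at most the factor β and the change of centre costs at most D,
  -- so the window cannot be jumped over.
  set η' : ℝ := β * η / D with hη'
  have hη'0 : 0 < η' := by positivity
  -- The first bound forces the return f^j y = y; the second makes the pulled-back distance less
  -- than β r.
  obtain ⟨e, he, he1, he2⟩ : ∃ e : ℝ, 0 < e ∧ 2 * e ≤ δ / 2 ∧ D ^ 2 * (2 * e) ≤ β * η' := by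
    refine ⟨min (δ / 4) (β * η' / (2 * D ^ 2)), by positivity, ?_, ?_⟩
    · linarith [min_le_left (δ / 4) (β * η' / (2 * D ^ 2))]
    · have := min_le_right (δ / 4) (β * η' / (2 * D ^ 2))
      rw [le_div_iff₀ (by positivity)] at this
      linarith
  obtain ⟨ε₁, hε₁, hcont⟩ := exists_forall_lt_dist_iterate_lt hf y N he
  obtain ⟨ε, hε, hεe, hεε⟩ : ∃ ε : ℝ, 0 < ε ∧ ε ≤ e ∧ ε ≤ ε₁ :=
    ⟨min e ε₁, lt_min he hε₁, min_le_left _ _, min_le_right _ _⟩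
  let active (q : X × ℝ) (k : ℕ) : Prop :=
    η' ≤ iterFactor f a k q.1 * q.2 ∧ iterFactor f a k q.1 * q.2 ≤ η
  let bad (q : X × ℝ) (p : X) : Prop :=
    p ∈ gameBall q ∧ ∃ k, active q k ∧ dist (f^[k] p) y < ε
  have hwindow : ∀ (q : X × ℝ) (k j : ℕ), 0 < q.2 → active q k → active q (k + j) → j < N := by
    intro q k j hq hk hkj
    by_contra! hj
    have e1 : c * σ ^ N ≤ iterFactor f a j (f^[k] q.1) :=
      le_trans (by gcongr; exact hσ.le) (hexp j _)
    have e2 := hkj.2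
    rw [iterFactor_add] at e2
    have e3 : η' * (c * σ ^ N) ≤ η := by
      calc _ ≤ iterFactor f a k q.1 * q.2 * iterFactor f a j (f^[k] q.1) := by
            gcongr
            exacts [(mul_pos (hF _ _) hq).le, hk.1]
        _ = iterFactor f a k q.1 * iterFactor f a j (f^[k] q.1) * q.2 := by ring
        _ ≤ η := e2
    rw [hη', div_mul_eq_mul_div, div_le_iff₀ hD0] at e3
    have : η * (σ ^ N * (β * c)) ≤ η * D := by linarith
    exact absurd (le_of_mul_le_mul_left this hη) hN.not_ge
  have hclose : ∀ (q : X × ℝ), 0 < q.2 → ∀ k j p p', p ∈ gameBall q → p' ∈ gameBall q →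
      active q k → active q (k + j) → dist (f^[k] p) y < ε → dist (f^[k + j] p') y < ε →
      dist p p' < β * q.2 := by
    intro q hq k j p p' hp hp' hk hkj hy hy'
    have hj := hwindow q k j hq hk hkj
    rw [gameBall, mem_closedBall] at hp hp'
    have hqk := hkj.2
    have hFq := hF (k + j) q.1
    have d1 : iterFactor f a (k + j) q.1 * dist q.1 p ≤ η := by
      rw [dist_comm]
      exact le_trans (by gcongr) hqk
    have hηκ : η ≤ κ := by nlinarith
    have d2 := (h q.1 p (k + j) (d1.trans hηκ)).2.2
    -- Distortion is controlled from a base point, so the factor is moved from the centre to p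
    -- before p and p' are compared.
    have hFp := hF (k + j) p
    have d3 : iterFactor f a (k + j) p * dist p q.1 ≤ κ := by
      calc _ ≤ D * iterFactor f a (k + j) q.1 * q.2 := by gcongr
        _ ≤ D * η := by rw [mul_assoc]; gcongr
        _ ≤ κ := by nlinarith
    have d4 := (h p q.1 (k + j) d3).2.2
    have d5 : iterFactor f a (k + j) p * dist p p' ≤ 2 * D * η := by
      have : dist p p' ≤ 2 * q.2 := by
        linarith [dist_triangle_right p p' q.1]
      calc _ ≤ D * iterFactor f a (k + j) q.1 * (2 * q.2) := by gcongr
        _ = 2 * D * (iterFactor f a (k + j) q.1 * q.2) := by ring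
        _ ≤ _ := by gcongr
    obtain ⟨d6, d7, -⟩ := h p p' (k + j) (d5.trans h1)
    have d8 : dist (f^[k + j] p) (f^[k + j] p') ≤ δ / 2 := by
      calc _ ≤ D * (2 * D * η) := d7.trans (by gcongr)
        _ = 2 * D ^ 2 * η := by ring
        _ ≤ _ := h2
    have d9 : dist (f^[k + j] p) (f^[j] y) < e := by
      rw [add_comm, Function.iterate_add_apply]
      exact hcont j hj _ (hy.trans_le hεε)
    have d10 : f^[j] y = y := by
      refine hgap j hj ?_
      have t1 := dist_triangle (f^[j] y) (f^[k + j] p) y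
      have t2 := dist_triangle (f^[k + j] p) (f^[k + j] p') y
      rw [dist_comm (f^[j] y) (f^[k + j] p)] at t1
      linarith
    rw [d10] at d9
    have d11 : dist (f^[k + j] p) (f^[k + j] p') < 2 * e := by
      have := dist_triangle_right (f^[k + j] p) (f^[k + j] p') y
      linarith
    have d12 : η' * dist p p' < β * η' * q.2 := by
      calc η' * dist p p' ≤ iterFactor f a (k + j) q.1 * q.2 * dist p p' := by
            gcongr
            exact hkj.1
        _ ≤ (D * iterFactor f a (k + j) p) * q.2 * dist p p' := by gcongr
        _ = D * q.2 * (iterFactor f a (k + j) p * dist p p') := by ring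
        _ ≤ D * q.2 * (D * dist (f^[k + j] p) (f^[k + j] p')) := by gcongr
        _ < D * q.2 * (D * (2 * e)) := by gcongr
        _ = D ^ 2 * (2 * e) * q.2 := by ring
        _ ≤ _ := by gcongr
    have : η' * dist p p' < η' * (β * q.2) := by linarith
    exact lt_of_mul_lt_mul_left this hη'0.le
  have hbad : ∀ (q : X × ℝ), 0 < q.2 → ∀ p p', bad q p → bad q p' → dist p p' < β * q.2 := by
    rintro q hq p p' ⟨hp, k, hk, hpy⟩ ⟨hp', k', hk', hpy'⟩
    rcases le_total k k' with hkk | hkk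
    · obtain ⟨j, rfl⟩ := Nat.exists_eq_add_of_le hkk
      exact hclose q hq k j p p' hp hp' hk hk' hpy hpy'
    · obtain ⟨j, rfl⟩ := Nat.exists_eq_add_of_le hkk
      rw [dist_comm]
      exact hclose q hq k' j p' p hp' hp hk' hk hpy' hpy
  classical
  -- Any bad point will do, as the others lie within β r of it. Without a bad point the choice is
  -- irrelevant and the centre serves as default.
  refine ⟨fun q => if hq : ∃ p, bad q p then hq.choose else q.1,
    fun b hb0 hb hbβ hbc hinf z hz hzP => ?_⟩
  have hzbad : ∀ i, ¬ bad (b i) z := by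
    intro i hi
    have hex : ∃ p, bad (b i) p := ⟨z, hi⟩
    refine hzP i ?_
    simp only [hex, dif_pos]
    exact hbad _ (hb i) _ _ hi hex.choose_spec
  refine mem_nonAccumulationSet_of_forall_le_dist hε fun k => ?_
  -- Take the first ball with F_k r ≤ η. If it is the initial one, F_k r ≥ c ρ ≥ η; otherwise the
  -- preceding ball was above η.
  obtain ⟨i, hi⟩ : ∃ i, active (b i) k := by
    have hex : ∃ i, iterFactor f a k (b i).1 * (b i).2 ≤ η := by
      obtain ⟨i, hi⟩ := hinf (η / (D * iterFactor f a k z)) (div_pos hη (mul_pos hD0 (hF k z)))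
      refine ⟨i, ?_⟩
      rw [lt_div_iff₀ (mul_pos hD0 (hF k z))] at hi
      have hzi : dist z (b i).1 ≤ (b i).2 := hz i
      have hpos := hF k z
      have hzz : iterFactor f a k z * dist z (b i).1 ≤ κ := by
        have : D * (iterFactor f a k z * dist z (b i).1) ≤ η := by
          calc _ ≤ D * (iterFactor f a k z * (b i).2) := by gcongr
            _ ≤ _ := by linarith
        nlinarith [mul_nonneg hpos.le (dist_nonneg (x := z) (y := (b i).1))]
      have := (h z _ k hzz).2.2
      have hbi := hb i
      calc _ ≤ D * iterFactor f a k z * (b i).2 := by gcongr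
        _ ≤ _ := by linarith
    classical
    refine ⟨Nat.find hex, ?_, Nat.find_spec hex⟩
    have hspec := Nat.find_spec hex
    have hmin := fun m => Nat.find_min hex (m := m)
    set i := Nat.find hex
    rcases Nat.eq_zero_or_pos i with hi | hi
    · have e1 : η ≤ iterFactor f a k (b i).1 * (b i).2 := by
        rw [hi]
        refine h4.trans ?_
        gcongr
        exacts [(hF _ _).le, hFc k _]
      refine le_trans ?_ e1
      rw [hη', div_le_iff₀ hD0]
      nlinarith
    · obtain ⟨m, hm⟩ := Nat.exists_eq_succ_of_ne_zero hi.ne'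
      have e1 := hmin m (by omega)
      rw [hm] at hspec ⊢
      rw [Nat.succ_eq_add_one] at hspec ⊢
      have e2 := hbβ m
      have e3 : dist (b (m + 1)).1 (b m).1 ≤ (b m).2 := hbc m
      have hF1 := hF k (b (m + 1)).1
      have e4 : iterFactor f a k (b (m + 1)).1 * dist (b (m + 1)).1 (b m).1 ≤ κ := by
        have : β * (iterFactor f a k (b (m + 1)).1 * dist (b (m + 1)).1 (b m).1) ≤ β * κ := by
          calc _ ≤ β * (iterFactor f a k (b (m + 1)).1 * (b m).2) := by gcongr
            _ = iterFactor f a k (b (m + 1)).1 * (β * (b m).2) := by ring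
            _ ≤ iterFactor f a k (b (m + 1)).1 * (b (m + 1)).2 := by gcongr
            _ ≤ _ := hspec.trans h3
        exact le_of_mul_le_mul_left this hβ
      have e5 := (h _ _ k e4).2.2
      have hbm := hb m
      rw [not_le] at e1
      rw [hη', div_le_iff₀ hD0]
      calc β * η ≤ β * (iterFactor f a k (b m).1 * (b m).2) := by gcongr
        _ ≤ β * (D * iterFactor f a k (b (m + 1)).1 * (b m).2) := by gcongr
        _ = D * iterFactor f a k (b (m + 1)).1 * (β * (b m).2) := by ring
        _ ≤ D * iterFactor f a k (b (m + 1)).1 * (b (m + 1)).2 := by gcongr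
        _ = _ := by ring
  have := hzbad i
  by_contra! hlt
  exact this ⟨hz i, k, hi, hlt⟩

end Escape

/-! ### From escaping choices to winning strategies -/

section Strategies

variable {X : Type*} [MetricSpace X]

/-- At small scales, every geodesic segment can almost be extended beyond its endpoint. -/
def AlmostExtendsSegments (X : Type*) [MetricSpace X] : Prop :=
  ∀ δ : ℝ, 0 < δ → ∃ R : ℝ, 0 < R ∧ ∀ (x p : X) (s : ℝ), dist x p ≤ R → 0 ≤ s → s ≤ R →
    ∃ w, dist x w ≤ s ∧ (1 - δ) * (dist x p + s) ≤ dist w p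

/-- In each ball one can choose a point such that every sequence of balls whose radii are not
bounded below and which avoids the chosen points shrinks to a point of `S`. -/
def HasEscapingChoice (S : Set X) : Prop :=
  ∀ β ρ : ℝ, 0 < β → β ≤ 1 → 0 < ρ →
    ∃ P : X × ℝ → X, ∀ b : ℕ → X × ℝ, ρ ≤ (b 0).2 → (∀ i, 0 < (b i).2) →
      (∀ i, β * (b i).2 ≤ (b (i + 1)).2) → (∀ i, (b (i + 1)).1 ∈ gameBall (b i)) →
      (∀ ε > 0, ∃ i, (b i).2 < ε) →
      ∀ z, (∀ i, z ∈ gameBall (b i)) → (∀ i, z ∉ ball (P (b i)) (β * (b i).2)) → z ∈ S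

/-- If p is at distance at least r / 2 from x, stay at x; otherwise go r / 2 beyond x on the segment
coming from p. -/
lemma AlmostExtendsSegments.exists_moveAway (hX : AlmostExtendsSegments X) {δ : ℝ} (hδ : 0 < δ) :
    ∃ R : ℝ, 0 < R ∧ ∀ (x p : X) (r : ℝ), 0 < r → r ≤ R →
      ∃ w, dist x w ≤ r / 2 ∧ (1 / 2 - δ) * r ≤ dist w p := by
  obtain ⟨R, hR, h⟩ := hX (min δ 1) (lt_min hδ one_pos)
  refine ⟨R, hR, fun x p r hr hrR => ?_⟩
  rcases le_total (r / 2) (dist x p) with hxp | hxp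
  · exact ⟨x, by rw [dist_self]; positivity, by nlinarith⟩
  · obtain ⟨w, hw, hwp⟩ := h x p (r / 2) (by linarith) (by linarith) (by linarith)
    refine ⟨w, hw, le_trans ?_ hwp⟩
    have h1 := min_le_left δ 1
    have h2 := min_le_right δ 1
    have h3 : 0 < min δ 1 := lt_min hδ one_pos
    nlinarith [dist_nonneg (x := x) (y := p)]

lemma nonempty_iInter_gameBall [CompactSpace X] {b : ℕ → X × ℝ} (hb : ∀ i, 0 ≤ (b i).2)
    (hsub : ∀ i, gameBall (b (i + 1)) ⊆ gameBall (b i)) : (⋂ i, gameBall (b i)).Nonempty :=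
  IsCompact.nonempty_iInter_of_sequence_nonempty_isCompact_isClosed _ hsub
    (fun i => ⟨(b i).1, mem_closedBall_self (hb i)⟩) isClosed_closedBall.isCompact
    fun _ => isClosed_closedBall

/-- Inside any ball, a run can be built that obeys all deletions. With ratio 1/8, the new centre is
at distance at least 3r/8 from the chosen point, so the new ball of radius r/8 misses the deleted
one, and r/2 + r/8 ≤ r keeps it inside the old ball. -/
lemma dense_of_hasEscapingChoice [CompactSpace X] (hX : AlmostExtendsSegments X) {S : Set X}
    (hS : HasEscapingChoice S) : Dense S := by
  obtain ⟨R, hR, haway⟩ := hX.exists_moveAway (δ := 1 / 8) (by norm_num)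
  refine Metric.dense_iff.2 fun x r hr => ?_
  set ρ := min (r / 2) R with hρ
  have hρ0 : 0 < ρ := by positivity
  obtain ⟨P, hP⟩ := hS (1 / 8) ρ (by norm_num) (by norm_num) hρ0
  have hmove : ∀ q : X × ℝ, ∃ w, 0 < q.2 → q.2 ≤ R →
      dist q.1 w ≤ q.2 / 2 ∧ (1 / 2 - 1 / 8) * q.2 ≤ dist w (P q) := by
    intro q
    by_cases hq : 0 < q.2 ∧ q.2 ≤ R
    · obtain ⟨w, hw⟩ := haway q.1 (P q) q.2 hq.1 hq.2
      exact ⟨w, fun _ _ => hw⟩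
    · exact ⟨q.1, fun h1 h2 => absurd ⟨h1, h2⟩ hq⟩
  choose W hW using hmove
  let b : ℕ → X × ℝ := fun i => (fun q : X × ℝ => (W q, q.2 / 8))^[i] (x, ρ)
  have hb : ∀ i, b (i + 1) = (W (b i), (b i).2 / 8) := fun i =>
    Function.iterate_succ_apply' _ _ _
  have hb0 : b 0 = (x, ρ) := rfl
  have hr : ∀ i, (b i).2 = ρ * (1 / 8) ^ i := by
    intro i
    induction i with
    | zero => simp [hb0]
    | succ i ih => rw [hb, ih, pow_succ]; ring
  have hpos : ∀ i, 0 < (b i).2 := fun i => by rw [hr]; positivity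
  have hle : ∀ i, (b i).2 ≤ R := fun i => by
    rw [hr]
    have h1 : ((1 : ℝ) / 8) ^ i ≤ 1 := pow_le_one₀ (by norm_num) (by norm_num)
    have h2 : ρ ≤ R := min_le_right _ _
    nlinarith
  have hsub : ∀ i, gameBall (b (i + 1)) ⊆ gameBall (b i) := by
    intro i z hz
    have h1 := (hW _ (hpos i) (hle i)).1
    rw [hb] at hz
    simp only [gameBall, mem_closedBall] at hz ⊢
    have h2 := dist_triangle_right z (b i).1 (W (b i))
    linarith [hpos i]
  obtain ⟨z, hz⟩ := nonempty_iInter_gameBall (fun i => (hpos i).le) hsub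
  rw [mem_iInter] at hz
  have hz0 : dist z x ≤ ρ := hz 0
  refine ⟨z, ?_, hP b le_rfl hpos (fun i => ?_) (fun i => ?_) (fun ε hε => ?_) z hz fun i hi => ?_⟩
  · rw [mem_ball]
    have : ρ ≤ r / 2 := min_le_left _ _
    linarith
  · rw [hb]; linarith
  · exact hsub i (mem_closedBall_self (hpos _).le)
  · obtain ⟨i, hi⟩ := exists_pow_lt_of_lt_one (div_pos hε hρ0) (show (1 : ℝ) / 8 < 1 by norm_num)
    refine ⟨i, ?_⟩
    rw [hr]
    rwa [lt_div_iff₀' hρ0] at hi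
  · have h1 := (hW _ (hpos i) (hle i)).2
    have h2 := hz (i + 1)
    rw [hb] at h2
    simp only [gameBall, mem_closedBall, mem_ball] at h2 hi
    have h3 := dist_triangle_left (W (b i)) (P (b i)) z
    linarith [hpos i]

/-- If the radii stay at least ρ, the ball of radius ρ / 2 about a limit point of the centres lies
in all the balls. This covers the runs of the absolute game in which Bob refuses to shrink. -/
lemma exists_mem_iInter_of_dense [CompactSpace X] {S : Set X} (hS : Dense S) {b : ℕ → X × ℝ}
    {ρ : ℝ} (hρ : 0 < ρ) (hb : ∀ i, ρ ≤ (b i).2)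
    (hsub : ∀ i, gameBall (b (i + 1)) ⊆ gameBall (b i)) : ((⋂ i, gameBall (b i)) ∩ S).Nonempty := by
  obtain ⟨x, φ, hφ, hx⟩ := CompactSpace.tendsto_subseq fun i => (b i).1
  obtain ⟨z, hzx, hzS⟩ := Metric.dense_iff.1 hS x (ρ / 2) (by positivity)
  refine ⟨z, mem_iInter.2 fun i => ?_, hzS⟩
  have hanti : Antitone fun i => gameBall (b i) := antitone_nat_of_succ_le hsub
  obtain ⟨m, hm, him⟩ := ((Metric.tendsto_nhds.1 hx (ρ / 2) (by positivity)).and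
    (hφ.tendsto_atTop.eventually_ge_atTop i)).exists
  refine hanti him ?_
  simp only [gameBall, mem_closedBall, Function.comp_apply, mem_ball] at hm hzx ⊢
  have := dist_triangle_right z (b (φ m)).1 x
  linarith [hb (φ m)]

theorem isAbsoluteWinning_of_hasEscapingChoice [CompactSpace X] (hX : AlmostExtendsSegments X)
    {S : Set X} (hS : HasEscapingChoice S) : IsAbsoluteWinning S := by
  intro β hβ hβ1
  have hdense := dense_of_hasEscapingChoice hX hS
  have hch : ∀ ρ : ℝ, ∃ P : X × ℝ → X, 0 < ρ → ∀ b : ℕ → X × ℝ, ρ ≤ (b 0).2 →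
      (∀ i, 0 < (b i).2) → (∀ i, β * (b i).2 ≤ (b (i + 1)).2) →
      (∀ i, (b (i + 1)).1 ∈ gameBall (b i)) → (∀ ε > 0, ∃ i, (b i).2 < ε) →
      ∀ z, (∀ i, z ∈ gameBall (b i)) → (∀ i, z ∉ ball (P (b i)) (β * (b i).2)) → z ∈ S := by
    intro ρ
    by_cases hρ : 0 < ρ
    · obtain ⟨P, hP⟩ := hS β ρ hβ (by linarith) hρ
      exact ⟨P, fun _ => hP⟩
    · exact ⟨Prod.fst, fun h => absurd h hρ⟩
  choose P hP using hch
  -- The escaping choice depends on a lower bound for the initial radius, so Alice fixes it once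
  -- Bob's first radius is known.
  let s : AliceStrategy (X × ℝ) (X × ℝ) := fun i h =>
    (P (h 0).2 (h (Fin.last i)), β * (h (Fin.last i)).2)
  have hs : ∀ b i, s.move b i = (P (b 0).2 (b i), β * (b i).2) := fun b i => by
    simp [AliceStrategy.move, s]
  refine ⟨s, fun b => ⟨fun i hleg => ?_, fun hleg => ?_⟩⟩
  · have hpos : ∀ j ≤ i, 0 < (b j).2 := by
      intro j
      induction j with
      | zero => exact fun _ => hleg 0 (Nat.zero_le _)
      | succ j ih =>
        intro hj
        exact lt_of_lt_of_le (mul_pos hβ (ih (by omega))) (hleg (j + 1) hj).2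
    rw [AbsoluteAliceLegal, hs]
    exact ⟨mul_pos hβ (hpos i le_rfl), le_rfl⟩
  · have hpos : ∀ j, 0 < (b j).2 := by
      intro j
      induction j with
      | zero => exact hleg 0
      | succ j ih => exact lt_of_lt_of_le (mul_pos hβ ih) (hleg (j + 1)).2
    have hsub : ∀ i, gameBall (b (i + 1)) ⊆ gameBall (b i) := fun i =>
      (hleg (i + 1)).1.trans sdiff_subset
    by_cases hinf : ∀ ε > 0, ∃ i, (b i).2 < ε
    · obtain ⟨z, hz⟩ := nonempty_iInter_gameBall (fun i => (hpos i).le) hsub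
      refine ⟨z, hz, ?_⟩
      rw [mem_iInter] at hz
      refine hP _ (hpos 0) b le_rfl hpos (fun i => (hleg (i + 1)).2)
        (fun i => hsub i (mem_closedBall_self (hpos _).le)) hinf z hz fun i hi => ?_
      have := ((hleg (i + 1)).1 (hz (i + 1))).2
      rw [hs] at this
      exact this hi
    · push Not at hinf
      obtain ⟨ρ, hρ, hb⟩ := hinf
      exact exists_mem_iInter_of_dense hdense hρ hb hsub

end Strategies

/-! ### Schmidt's game with α = 1/2 -/

section Schmidt

variable {X : Type*} [MetricSpace X]

/-- If `B(x, t) ⊆ B(x', r)` are small balls, then `dist x x' ≤ r - t` up to a small error. -/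
lemma dist_le_of_closedBall_subset {δ R r t : ℝ} {x x' : X} (hδ : 0 ≤ δ)
    (h : ∀ (x p : X) (s : ℝ), dist x p ≤ R → 0 ≤ s → s ≤ R →
      ∃ w, dist x w ≤ s ∧ (1 - δ) * (dist x p + s) ≤ dist w p)
    (ht : 0 ≤ t) (htr : t ≤ r) (hr : r ≤ R) (hsub : closedBall x t ⊆ closedBall x' r) :
    dist x x' ≤ r - t + 2 * δ * r := by
  have hx : dist x x' ≤ r := hsub (mem_closedBall_self ht)
  obtain ⟨w, hw, hwx⟩ := h x x' t (hx.trans hr) ht (htr.trans hr)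
  have : dist w x' ≤ r := hsub (by rwa [mem_closedBall, dist_comm])
  nlinarith

/-- Two turns of Schmidt's game allow Alice to avoid a ball around a given point. -/
lemma AlmostExtendsSegments.exists_avoid (hX : AlmostExtendsSegments X) {β : ℝ} (hβ : 0 < β)
    (hβ1 : β < 1) :
    ∃ R : ℝ, 0 < R ∧ ∀ (x p : X) (r : ℝ), 0 < r → r ≤ R → ∃ w, dist x w ≤ r / 2 ∧
      ∀ x', closedBall x' (β * (r / 2)) ⊆ closedBall w (r / 2) →
        ∀ z ∈ closedBall x' (β * (r / 2) / 2), β ^ 2 / 8 * r ≤ dist z p := by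
  -- With both errors β / 16: d(w, p) ≥ (1/2 - β/16) r, d(x', w) ≤ (1/2 - β/2 + β/16) r and d(z, x')
  -- ≤ β r / 4, which leaves d(z, p) ≥ β r / 8.
  obtain ⟨R₁, hR₁, h₁⟩ := hX.exists_moveAway (δ := β / 16) (by positivity)
  obtain ⟨R₂, hR₂, h₂⟩ := hX (β / 16) (by positivity)
  refine ⟨min R₁ R₂, lt_min hR₁ hR₂, fun x p r hr hrR => ?_⟩
  obtain ⟨w, hw, hwp⟩ := h₁ x p r hr (hrR.trans (min_le_left _ _))
  refine ⟨w, hw, fun x' hx' z hz => ?_⟩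
  have h3 := dist_le_of_closedBall_subset (by positivity) h₂ (by positivity) (by nlinarith)
    (by linarith [hrR.trans (min_le_right R₁ R₂)]) hx'
  rw [mem_closedBall] at hz
  have h4 := dist_triangle w z p
  have h5 := dist_triangle w x' z
  rw [dist_comm w x', dist_comm x' z] at h5
  have h6 : β ^ 2 * r ≤ β * r := by nlinarith [mul_pos hβ hr]
  nlinarith

/-- Alice waits until the balls are small, then alternates between moving away from the chosen point
and playing concentrically. The first kind of move alone may let Bob's ball touch the point; the
concentric halving creates the gap. Every second ball of Bob then forms an escaping sequence. -/
theorem isSchmidtWinning_half_of_hasEscapingChoice [CompactSpace X]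
    (hX : AlmostExtendsSegments X) {S : Set X} (hS : HasEscapingChoice S) :
    IsSchmidtWinning (1 / 2) S := by
  intro β hβ hβ1
  obtain ⟨R, hR, havoid⟩ := hX.exists_avoid hβ hβ1
  have hq : 0 < β / 2 := by positivity
  have hq1 : β / 2 < 1 := by linarith
  -- the turn from which on the balls are small
  have hstart : ∀ r : ℝ, ∃ N : ℕ, r * (β / 2) ^ N ≤ R := by
    intro r
    have h1 := (tendsto_pow_atTop_nhds_zero_of_lt_one hq.le hq1).const_mul r
    rw [mul_zero] at h1
    obtain ⟨N, hN⟩ := (h1.eventually (gt_mem_nhds hR)).exists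
    exact ⟨N, hN.le⟩
  choose N hN using hstart
  have hch : ∀ ρ : ℝ, ∃ P : X × ℝ → X, 0 < ρ → ∀ b : ℕ → X × ℝ, ρ ≤ (b 0).2 →
      (∀ i, 0 < (b i).2) → (∀ i, β ^ 2 / 8 * (b i).2 ≤ (b (i + 1)).2) →
      (∀ i, (b (i + 1)).1 ∈ gameBall (b i)) → (∀ ε > 0, ∃ i, (b i).2 < ε) →
      ∀ z, (∀ i, z ∈ gameBall (b i)) → (∀ i, z ∉ ball (P (b i)) (β ^ 2 / 8 * (b i).2)) →
      z ∈ S := by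
    intro ρ
    by_cases hρ : 0 < ρ
    -- The constant serves twice: it is below the ratio β² / 4 of radii two turns apart, and it is
    -- the relative size of the ball that two turns avoid.
    · obtain ⟨P, hP⟩ := hS (β ^ 2 / 8) ρ (by positivity) (by nlinarith) hρ
      exact ⟨P, fun _ => hP⟩
    · exact ⟨Prod.fst, fun h => absurd h hρ⟩
  choose P hP using hch
  have hmove : ∀ (q : X × ℝ) (p : X), ∃ w, (0 < q.2 → dist q.1 w ≤ q.2 / 2) ∧
      (0 < q.2 → q.2 ≤ R → ∀ x', closedBall x' (β * (q.2 / 2)) ⊆ closedBall w (q.2 / 2) →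
        ∀ z ∈ closedBall x' (β * (q.2 / 2) / 2), β ^ 2 / 8 * q.2 ≤ dist z p) := by
    intro q p
    by_cases hq : 0 < q.2 ∧ q.2 ≤ R
    · obtain ⟨w, hw, hw'⟩ := havoid q.1 p q.2 hq.1 hq.2
      exact ⟨w, fun _ => hw, fun _ _ => hw'⟩
    · exact ⟨q.1, fun h => by rw [dist_self]; positivity, fun h1 h2 => absurd ⟨h1, h2⟩ hq⟩
  choose W hW hWavoid using hmove
  classical
  let start : ℝ → ℝ := fun r => r * (β / 2) ^ N r
  let s : AliceStrategy (X × ℝ) (X × ℝ) := fun i h =>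
    (if ∃ m, i = N (h 0).2 + 2 * m then
      W (h (Fin.last i)) (P (start (h 0).2) (h (Fin.last i))) else (h (Fin.last i)).1,
      1 / 2 * (h (Fin.last i)).2)
  have hs : ∀ b i, s.move b i = (if ∃ m, i = N (b 0).2 + 2 * m then
      W (b i) (P (start (b 0).2) (b i)) else (b i).1, 1 / 2 * (b i).2) := fun b i => rfl
  have hdist : ∀ b i, 0 < (b i).2 → dist (b i).1 (s.move b i).1 ≤ (b i).2 / 2 := by
    intro b i hb
    rw [hs]
    dsimp only
    split_ifs
    · exact hW _ _ hb
    · rw [dist_self]; positivity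
  have hsubA : ∀ b i, 0 < (b i).2 → gameBall (s.move b i) ⊆ gameBall (b i) := by
    intro b i hb
    refine closedBall_subset_closedBall' ?_
    have h1 := hdist b i hb
    have h2 : (s.move b i).2 = 1 / 2 * (b i).2 := by rw [hs]
    rw [dist_comm, h2]
    linarith
  have hrad : ∀ (b : ℕ → X × ℝ) (i : ℕ), (∀ j ≤ i, SchmidtBobLegal β (s.move b) b j) →
      (b i).2 = (b 0).2 * (β / 2) ^ i := by
    intro b i
    induction i with
    | zero => simp
    | succ i ih =>
      intro hleg
      rw [(hleg (i + 1) le_rfl).2, hs, ih fun j hj => hleg j (by omega), pow_succ]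
      ring
  have hpos : ∀ (b : ℕ → X × ℝ) (i : ℕ), (∀ j ≤ i, SchmidtBobLegal β (s.move b) b j) →
      0 < (b i).2 := by
    intro b i hleg
    rw [hrad b i hleg]
    have : 0 < (b 0).2 := hleg 0 (Nat.zero_le _)
    positivity
  refine ⟨s, fun b => ⟨fun i hleg => ⟨hsubA b i (hpos b i hleg), by rw [hs]⟩, fun hleg => ?_⟩⟩
  have hrad' : ∀ i, (b i).2 = (b 0).2 * (β / 2) ^ i := fun i => hrad b i fun j _ => hleg j
  have hpos' : ∀ i, 0 < (b i).2 := fun i => hpos b i fun j _ => hleg j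
  have hsub : ∀ i, gameBall (b (i + 1)) ⊆ gameBall (b i) := fun i =>
    (hleg (i + 1)).1.trans (hsubA b i (hpos' i))
  have hanti : Antitone fun i => gameBall (b i) := antitone_nat_of_succ_le hsub
  have hlim : Filter.Tendsto (fun i => (b i).2) Filter.atTop (𝓝 0) := by
    have h1 := (tendsto_pow_atTop_nhds_zero_of_lt_one hq.le hq1).const_mul (b 0).2
    rw [mul_zero] at h1
    exact h1.congr fun i => (hrad' i).symm
  obtain ⟨z, hz⟩ := nonempty_iInter_gameBall (fun i => (hpos' i).le) hsub
  have hzi := mem_iInter.1 hz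
  refine ⟨z, ?_, ?_⟩
  · set n₀ := N (b 0).2 with hn₀
    have hstart0 : 0 < start (b 0).2 := mul_pos (hpos' 0) (by positivity)
    refine hP (start (b 0).2) hstart0 (fun m => b (n₀ + 2 * m)) ?_ (fun m => hpos' _)
      (fun m => ?_) (fun m => ?_) (fun ε hε => ?_) z (fun m => hzi _) fun m hm => ?_
    · exact (hrad' n₀).ge
    · have := hpos' (n₀ + 2 * m)
      have h2 : (b (n₀ + 2 * (m + 1))).2 = (b (n₀ + 2 * m)).2 * (β / 2) ^ 2 := by
        rw [hrad', hrad' (n₀ + 2 * m), mul_assoc, ← pow_add]; rfl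
      rw [h2]
      nlinarith [mul_pos (pow_pos hβ 2) this]
    · exact hanti (show n₀ + 2 * m ≤ n₀ + 2 * (m + 1) by omega)
        (mem_closedBall_self (hpos' _).le)
    · obtain ⟨m, hm⟩ := Filter.eventually_atTop.1 (hlim.eventually (gt_mem_nhds hε))
      exact ⟨m, hm _ (by omega)⟩
    · set i := n₀ + 2 * m with hi
      have hai : s.move b i = (W (b i) (P (start (b 0).2) (b i)), 1 / 2 * (b i).2) := by
        rw [hs, if_pos ⟨m, hi⟩]
      have hsmall : (b i).2 ≤ R := by
        refine le_trans ?_ (hN (b 0).2)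
        rw [hrad']
        have := hpos' 0
        gcongr ?_ * ?_
        exact pow_le_pow_of_le_one hq.le hq1.le (by omega)
      have h1 := (hleg (i + 1)).1
      have h1r := (hleg (i + 1)).2
      have h2 := (hleg (i + 2)).1 (hzi (i + 2))
      have h3 := hdist b (i + 1) (hpos' _)
      rw [hai] at h1 h1r
      dsimp only at h1r
      have h4 : (b (i + 1)).2 = β * ((b i).2 / 2) := by rw [h1r]; ring
      have h5 := hWavoid (b i) (P (start (b 0).2) (b i)) (hpos' i) hsmall (b (i + 1)).1
        (by
          rw [← h4]
          refine h1.trans ?_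
          rw [gameBall, show 1 / 2 * (b i).2 = (b i).2 / 2 by ring]) z
      have hnot : ¬ ∃ m', i + 1 = n₀ + 2 * m' := by
        rintro ⟨m', hm'⟩
        omega
      have h6 : s.move b (i + 1) = ((b (i + 1)).1, 1 / 2 * (b (i + 1)).2) := by
        rw [hs, if_neg hnot]
      rw [h6, h4] at h2
      have h7 := h5 (by
        rw [gameBall] at h2
        rwa [div_eq_inv_mul (β * _), ← one_div])
      rw [mem_ball] at hm
      exact absurd h7 hm.not_ge
  · refine Subset.antisymm (fun w hw => ?_) (singleton_subset_iff.2 hz)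
    have hwi := mem_iInter.1 hw
    have : dist w z ≤ 0 := by
      have h1 : Filter.Tendsto (fun i => 2 * (b i).2) Filter.atTop (𝓝 (2 * 0)) :=
        hlim.const_mul 2
      rw [mul_zero] at h1
      refine ge_of_tendsto' h1 fun i => ?_
      have h2 : dist w (b i).1 ≤ (b i).2 := hwi i
      have h3 : dist z (b i).1 ≤ (b i).2 := hzi i
      linarith [dist_triangle_right w z (b i).1]
    exact dist_le_zero.1 this

end Schmidt

/-! ### Riemannian distance and metric in a chart -/

section Geometry

open MeasureTheory Filter
open scoped ENNReal

variable {E : Type*} [NormedAddCommGroup E] [NormedSpace ℝ E]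
  {H : Type*} [TopologicalSpace H] {I : ModelWithCorners ℝ E H}
  {M : Type*} [MetricSpace M] [ChartedSpace H M] [IsManifold I ∞ M]

variable (I) in
/-- The coordinates at `q` of a tangent vector, in the chart at `x₀`. -/
noncomputable def chartCoord (x₀ q : M) : TangentSpace I q →L[ℝ] E :=
  (trivializationAt E (TangentSpace I : M → Type _) x₀).continuousLinearMapAt ℝ q

variable (I) in
/-- The tangent vector at `q` with given coordinates, in the chart at `x₀`. -/
noncomputable def chartVec (x₀ q : M) : E →L[ℝ] TangentSpace I q :=
  (trivializationAt E (TangentSpace I : M → Type _) x₀).symmL ℝ q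

lemma chartVec_chartCoord {x₀ q : M} (hq : q ∈ (chartAt H x₀).source) (v : TangentSpace I q) :
    chartVec I x₀ q (chartCoord I x₀ q v) = v :=
  (trivializationAt E (TangentSpace I : M → Type _) x₀).symmL_continuousLinearMapAt (by simpa using hq) v

lemma chartCoord_chartVec {x₀ q : M} (hq : q ∈ (chartAt H x₀).source) (w : E) :
    chartCoord I x₀ q (chartVec I x₀ q w) = w :=
  (trivializationAt E (TangentSpace I : M → Type _) x₀).continuousLinearMapAt_symmL (by simpa using hq) w

lemma hasMFDerivAt_extChartAt_chartCoord {x₀ q : M} (hq : q ∈ (chartAt H x₀).source) :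
    HasMFDerivAt I 𝓘(ℝ, E) (extChartAt I x₀) q (chartCoord I x₀ q) := by
  rw [chartCoord, TangentBundle.continuousLinearMapAt_trivializationAt hq]
  exact (mdifferentiableAt_extChartAt hq).hasMFDerivAt

lemma hasMFDerivAt_extChartAt_symm_chartVec [I.Boundaryless] {x₀ : M} {p : E}
    (hp : p ∈ (extChartAt I x₀).target) :
    HasMFDerivAt 𝓘(ℝ, E) I (extChartAt I x₀).symm p
      (chartVec I x₀ ((extChartAt I x₀).symm p)) := by
  have hs : (extChartAt I x₀).symm p ∈ (chartAt H x₀).source := by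
    have := (extChartAt I x₀).map_target hp
    rwa [extChartAt_source] at this
  rw [chartVec, TangentBundle.symmL_trivializationAt hs, (extChartAt I x₀).right_inv hp,
    I.range_eq_univ, mfderivWithin_univ]
  have := mdifferentiableWithinAt_extChartAt_symm (I := I) hp
  rw [I.range_eq_univ, mdifferentiableWithinAt_univ] at this
  exact this.hasMFDerivAt

variable [RiemannianBundle (fun x : M => TangentSpace I x)]

/-- A bound for the distance in the chart, through a linear map. -/
lemma norm_map_extChartAt_sub_le [IsRiemannianManifold I M]
    {F : Type*} [NormedAddCommGroup F] [NormedSpace ℝ F] (L : E →L[ℝ] F)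
    {x₀ a b : M} {R K : ℝ} (hK : 0 ≤ K) (hsub : ball a R ⊆ (chartAt H x₀).source)
    (hL : ∀ q ∈ ball a R, ∀ v : TangentSpace I q, ‖L (chartCoord I x₀ q v)‖ ≤ K * ‖v‖)
    (hab : dist a b < R) :
    ‖L (extChartAt I x₀ b) - L (extChartAt I x₀ a)‖ ≤ K * dist a b := by
  have hR : 0 < R := dist_nonneg.trans_lt hab
  -- it suffices to bound by the length of short paths
  suffices Hr : ∀ r : ℝ, dist a b < r → r < R →
      ‖L (extChartAt I x₀ b) - L (extChartAt I x₀ a)‖ ≤ K * r by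
    have h1 : Tendsto (fun r : ℝ => K * r) (𝓝[>] (dist a b)) (𝓝 (K * dist a b)) :=
      (tendsto_const_nhds.mul tendsto_id).mono_left nhdsWithin_le_nhds
    refine ge_of_tendsto h1 ?_
    filter_upwards [self_mem_nhdsWithin, mem_nhdsWithin_of_mem_nhds (gt_mem_nhds hab)]
      with r h1 h2 using Hr r h1 h2
  intro r hr hrR
  have hr0 : 0 < r := dist_nonneg.trans_lt hr
  have hed : riemannianEDist I a b < ENNReal.ofReal r := by
    rw [← IsRiemannianManifold.out (I := I) a b, edist_dist]
    exact (ENNReal.ofReal_lt_ofReal_iff hr0).2 hr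
  obtain ⟨γ, γ0, γ1, hγ, hlen⟩ := exists_lt_of_riemannianEDist_lt hed
  -- A path of length less than R cannot leave the ball: each initial piece bounds the distance from
  -- a.
  have hin : ∀ t ∈ Icc (0 : ℝ) 1, γ t ∈ ball a R := by
    intro t ht
    have h1 : riemannianEDist I a (γ t) ≤ pathELength I γ 0 t :=
      riemannianEDist_le_pathELength (hγ.mono (Icc_subset_Icc_right ht.2)) γ0 rfl ht.1
    have h2 : edist a (γ t) < ENNReal.ofReal r := by
      rw [IsRiemannianManifold.out (I := I) a (γ t)]
      exact (h1.trans (pathELength_mono le_rfl ht.2)).trans_lt hlen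
    rw [edist_dist, ENNReal.ofReal_lt_ofReal_iff hr0] at h2
    rw [mem_ball']
    exact h2.trans hrR
  have hγE : ContDiffOn ℝ 1 (fun t => L (extChartAt I x₀ (γ t))) (Icc 0 1) := by
    refine L.contDiff.comp_contDiffOn ?_
    rw [← contMDiffOn_iff_contDiffOn]
    exact (contMDiffOn_extChartAt (n := 1)).comp hγ fun t ht => hsub (hin t ht)
  have hfin : ENNReal.ofReal K * ENNReal.ofReal r ≠ ⊤ :=
    ENNReal.mul_ne_top ENNReal.ofReal_ne_top ENNReal.ofReal_ne_top
  have key : ‖L (extChartAt I x₀ b) - L (extChartAt I x₀ a)‖ₑ ≤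
      ENNReal.ofReal K * ENNReal.ofReal r := by
    calc _ = ‖L (extChartAt I x₀ (γ 1)) - L (extChartAt I x₀ (γ 0))‖ₑ := by rw [γ0, γ1]
      _ ≤ ∫⁻ t in Icc 0 1, ‖derivWithin (fun t => L (extChartAt I x₀ (γ t))) (Icc 0 1) t‖ₑ :=
        enorm_sub_le_lintegral_derivWithin_Icc_of_contDiffOn_Icc hγE zero_le_one
      _ ≤ ∫⁻ t in Icc 0 1, ENNReal.ofReal K * ‖mfderivWithin 𝓘(ℝ, ℝ) I γ (Icc 0 1) t 1‖ₑ := by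
        refine setLIntegral_mono' measurableSet_Icc fun t ht => ?_
        have hu : UniqueDiffWithinAt ℝ (Icc (0 : ℝ) 1) t := uniqueDiffOn_Icc zero_lt_one t ht
        have h1 : HasMFDerivWithinAt 𝓘(ℝ, ℝ) I γ (Icc 0 1) t
            (mfderivWithin 𝓘(ℝ, ℝ) I γ (Icc 0 1) t) :=
          ((hγ.mdifferentiableOn one_ne_zero) t ht).hasMFDerivWithinAt
        have h2 := (hasMFDerivAt_extChartAt_chartCoord (I := I) (hsub (hin t ht)))
          |>.comp_hasMFDerivWithinAt t h1
        have h3 := h2.hasFDerivWithinAt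
        have h4 := (L.hasFDerivAt.comp_hasFDerivWithinAt t h3).hasDerivWithinAt
        have h5 := h4.derivWithin hu
        have h6 : derivWithin (fun t => L (extChartAt I x₀ (γ t))) (Icc 0 1) t =
          L (chartCoord I x₀ (γ t) (mfderivWithin 𝓘(ℝ, ℝ) I γ (Icc 0 1) t 1)) := h5
        rw [h6, ← ofReal_norm, ← ofReal_norm, ← ENNReal.ofReal_mul hK]
        exact ENNReal.ofReal_le_ofReal (hL _ (hin t ht) _)
      _ = ENNReal.ofReal K * pathELength I γ 0 1 := by
        rw [lintegral_const_mul' _ _ ENNReal.ofReal_ne_top,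
          pathELength_eq_lintegral_mfderivWithin_Icc]
      _ ≤ _ := by gcongr
  rw [← ofReal_norm, ← ENNReal.ofReal_mul hK] at key
  exact (ENNReal.ofReal_le_ofReal_iff (by positivity)).1 key

/-- A bound for the Riemannian distance by the length of a segment in a chart. -/
lemma dist_symm_extChartAt_le [I.Boundaryless] [IsRiemannianManifold I M]
    {x₀ a b : M} {K : ℝ} (hK : 0 ≤ K) (ha : a ∈ (chartAt H x₀).source)
    (hb : b ∈ (chartAt H x₀).source)
    (hsub : segment ℝ (extChartAt I x₀ a) (extChartAt I x₀ b) ⊆ (extChartAt I x₀).target)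
    (hL : ∀ p ∈ segment ℝ (extChartAt I x₀ a) (extChartAt I x₀ b),
      ‖chartVec I x₀ ((extChartAt I x₀).symm p) (extChartAt I x₀ b - extChartAt I x₀ a)‖ ≤ K) :
    dist a b ≤ K := by
  set η : ℝ → E := fun t => AffineMap.lineMap (extChartAt I x₀ a) (extChartAt I x₀ b) t with hη
  have hηd : ∀ t, HasDerivAt η (extChartAt I x₀ b - extChartAt I x₀ a) t := fun t =>
    AffineMap.hasDerivAt_lineMap
  have hηC : ContDiff ℝ 1 η := (ContinuousAffineMap.lineMap (R := ℝ) (extChartAt I x₀ a)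
    (extChartAt I x₀ b)).contDiff
  have hηs : ∀ t ∈ Icc (0 : ℝ) 1, η t ∈ segment ℝ (extChartAt I x₀ a) (extChartAt I x₀ b) := by
    intro t ht
    rw [segment_eq_image_lineMap]
    exact mem_image_of_mem _ ht
  set γ : ℝ → M := fun t => (extChartAt I x₀).symm (η t) with hγdef
  have ha' : a ∈ (extChartAt I x₀).source := by rwa [extChartAt_source]
  have hb' : b ∈ (extChartAt I x₀).source := by rwa [extChartAt_source]
  have hγ : ContMDiffOn 𝓘(ℝ, ℝ) I 1 γ (Icc 0 1) :=
    (contMDiffOn_extChartAt_symm (n := 1) x₀).comp hηC.contMDiff.contMDiffOn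
      fun t ht => hsub (hηs t ht)
  have h1 : riemannianEDist I a b ≤ pathELength I γ 0 1 :=
    riemannianEDist_le_pathELength hγ (by simp [hγdef, hη, -extChartAt, (extChartAt I x₀).left_inv ha'])
      (by simp [hγdef, hη, -extChartAt, (extChartAt I x₀).left_inv hb']) zero_le_one
  rw [← IsRiemannianManifold.out (I := I) a b, edist_dist] at h1
  refine (ENNReal.ofReal_le_ofReal_iff hK).1 (h1.trans ?_)
  rw [pathELength_eq_lintegral_mfderivWithin_Icc]
  calc _ ≤ ∫⁻ t in Icc (0 : ℝ) 1, ENNReal.ofReal K := by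
        refine setLIntegral_mono' measurableSet_Icc fun t ht => ?_
        have hu : UniqueMDiffWithinAt 𝓘(ℝ, ℝ) (Icc (0 : ℝ) 1) t := by
          rw [uniqueMDiffWithinAt_iff_uniqueDiffWithinAt]
          exact uniqueDiffOn_Icc zero_lt_one t ht
        have h2 : HasMFDerivWithinAt 𝓘(ℝ, ℝ) 𝓘(ℝ, E) η (Icc 0 1) t _ :=
          (hηd t).hasFDerivAt.hasMFDerivAt.hasMFDerivWithinAt
        have h3 := (hasMFDerivAt_extChartAt_symm_chartVec (I := I) (hsub (hηs t ht)))
          |>.comp_hasMFDerivWithinAt t h2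
        have h4 : mfderivWithin 𝓘(ℝ, ℝ) I γ (Icc 0 1) t 1 =
            chartVec I x₀ (γ t) (extChartAt I x₀ b - extChartAt I x₀ a) := by
          have h5 := h3.mfderivWithin hu
          have h6 := congrArg (fun A => A (1 : ℝ)) h5
          exact h6.trans (congrArg (chartVec I x₀ (γ t)) (one_smul ℝ _))
        rw [h4, ← ofReal_norm]
        exact ENNReal.ofReal_le_ofReal (hL _ (hηs t ht))
    _ = _ := by simp

variable [IsContMDiffRiemannianBundle I ∞ E (fun x : M => TangentSpace I x)]

lemma isContinuousRiemannianBundle_tangentSpace :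
    IsContinuousRiemannianBundle E (fun x : M => TangentSpace I x) := by
  have h : IsContMDiffRiemannianBundle I ∞ E (fun x : M => TangentSpace I x) := inferInstance
  obtain ⟨g, hg, hgi⟩ := h.exists_contMDiff
  exact ⟨g, hg.continuous, hgi⟩

lemma eventually_norm_chartCoord_le (x₀ : M) :
    ∃ C > 0, ∀ᶠ q in 𝓝 x₀, ∀ v, ‖chartCoord I x₀ q v‖ ≤ C * ‖v‖ := by
  have := isContinuousRiemannianBundle_tangentSpace (I := I) (M := M)
  obtain ⟨C, hC, h⟩ := eventually_norm_trivializationAt_lt E (fun x : M => TangentSpace I x) x₀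
  exact ⟨C, hC, h.mono fun q hq v => ContinuousLinearMap.le_of_opNorm_le _ hq.le v⟩

lemma eventually_norm_chartVec_le (x₀ : M) :
    ∃ C > 0, ∀ᶠ q in 𝓝 x₀, ∀ w, ‖chartVec I x₀ q w‖ ≤ C * ‖w‖ := by
  have := isContinuousRiemannianBundle_tangentSpace (I := I) (M := M)
  obtain ⟨C, hC, h⟩ := eventually_norm_symmL_trivializationAt_lt E (fun x : M => TangentSpace I x) x₀
  exact ⟨C, hC, h.mono fun q hq v => ContinuousLinearMap.le_of_opNorm_le _ hq.le v⟩

/-- The metric tensor read in the trivialization at x₀: smoothness of the Riemannian bundle becomes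
smoothness of a map into a fixed space of bilinear forms. -/
lemma exists_metric_coordinates (x₀ : M) :
    ∃ g : M → E →L[ℝ] E →L[ℝ] ℝ, ContMDiffAt I 𝓘(ℝ, E →L[ℝ] E →L[ℝ] ℝ) 1 g x₀ ∧
      ∀ᶠ q in 𝓝 x₀, ∀ w, g q w w = ‖chartVec I x₀ q w‖ ^ 2 := by
  have : IsContMDiffRiemannianBundle I 1 E (fun x : M => TangentSpace I x) := inferInstance
  obtain ⟨g, hg, hgi⟩ := this.exists_contMDiff
  refine ⟨fun y => ContinuousLinearMap.inCoordinates E (TangentSpace I) (E →L[ℝ] ℝ)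
    (fun x : M => TangentSpace I x →L[ℝ] ℝ) x₀ y x₀ y (g y), ?_, ?_⟩
  · have := hg x₀
    rw [contMDiffAt_hom_bundle] at this
    exact this.2
  · filter_upwards [chart_source_mem_nhds H x₀] with q hq w
    have hq' : q ∈ (trivializationAt E (TangentSpace I : M → Type _) x₀).baseSet := by simpa using hq
    rw [inCoordinates_apply_eq₂ hq' hq' (Set.mem_univ _)]
    rw [← real_inner_self_eq_norm_sq, hgi]
    simp only [Trivial.fiberBundle_trivializationAt', Trivial.linearMapAt_trivialization,
      LinearMap.id_coe, id_eq]
    have hw : chartVec I x₀ q w =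
        (trivializationAt E (TangentSpace I : M → Type _) x₀).symm q w :=
      Trivialization.symmL_apply _ hq' _
    rw [hw]

-- A C^1 metric tensor is locally Lipschitz, which controls the difference a² - b² of squared norms.
-- Dividing by a + b is harmless since a is comparable to the coordinate norm of w.
set_option synthInstance.maxHeartbeats 400000 in
lemma eventually_abs_norm_chartVec_sub_le [I.Boundaryless] (x₀ : M) :
    ∃ C > 0, ∃ U ∈ 𝓝 x₀, ∀ u ∈ U, ∀ v ∈ U, ∀ w : E,
      |‖chartVec I x₀ u w‖ - ‖chartVec I x₀ v w‖| ≤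
        C * ‖extChartAt I x₀ u - extChartAt I x₀ v‖ * ‖w‖ := by
  obtain ⟨g, hg, hgN⟩ := exists_metric_coordinates (I := I) x₀
  obtain ⟨C₁, hC₁, h₁⟩ := eventually_norm_chartCoord_le (I := I) x₀
  have hg' : ContDiffAt ℝ 1 (g ∘ (extChartAt I x₀).symm) (extChartAt I x₀ x₀) := by
    have := (contMDiffAt_iff.1 hg).2
    rw [I.range_eq_univ, contDiffWithinAt_univ] at this
    exact this
  obtain ⟨K, t, ht, hK⟩ := hg'.exists_lipschitzOnWith
  have ht' := (continuousAt_extChartAt (I := I) x₀).preimage_mem_nhds ht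
  refine ⟨(K + 1) * C₁, by positivity, _, inter_mem (inter_mem ht' (extChartAt_source_mem_nhds (I := I) x₀))
    (inter_mem hgN (inter_mem h₁ (chart_source_mem_nhds H x₀))), ?_⟩
  rintro u ⟨⟨hut, hus⟩, hug, hu1, huc⟩ v ⟨⟨hvt, hvs⟩, hvg, hv1, hvc⟩ w
  have hL := hK.dist_le_mul _ hut _ hvt
  simp only [Function.comp_apply, (extChartAt I x₀).left_inv hus, (extChartAt I x₀).left_inv hvs,
    dist_eq_norm] at hL
  set a := ‖chartVec I x₀ u w‖
  set b := ‖chartVec I x₀ v w‖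
  have hab : |a ^ 2 - b ^ 2| ≤ K * ‖extChartAt I x₀ u - extChartAt I x₀ v‖ * ‖w‖ * ‖w‖ := by
    rw [← hug w, ← hvg w, ← Real.norm_eq_abs]
    calc _ = ‖(g u - g v) w w‖ := rfl
      _ ≤ ‖g u - g v‖ * ‖w‖ * ‖w‖ := ContinuousLinearMap.le_opNorm₂ _ _ _
      _ ≤ _ := by gcongr
  have ha : ‖w‖ ≤ C₁ * a := by
    simpa [chartCoord_chartVec huc] using hu1 (chartVec I x₀ u w)
  have ha0 : 0 ≤ a := norm_nonneg _
  have hb0 : 0 ≤ b := norm_nonneg _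
  rcases (norm_nonneg w).eq_or_lt with hw | hw
  · have : w = 0 := norm_eq_zero.1 hw.symm
    simp [a, b, this]
  have hapos : 0 < a := by
    by_contra! h
    nlinarith
  rw [show a ^ 2 - b ^ 2 = (a - b) * (a + b) by ring, abs_mul, abs_of_nonneg (by positivity : 0 ≤ a + b)] at hab
  have h3 : |a - b| * a ≤ ((K + 1) * C₁ * ‖extChartAt I x₀ u - extChartAt I x₀ v‖ * ‖w‖) * a := by
    calc |a - b| * a ≤ |a - b| * (a + b) := by gcongr; linarith
      _ ≤ _ := hab
      _ ≤ (K + 1) * ‖extChartAt I x₀ u - extChartAt I x₀ v‖ * ‖w‖ * (C₁ * a) := by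
        gcongr; linarith
      _ = _ := by ring
  exact le_of_mul_le_mul_right h3 hapos

end Geometry

/-! ### Comparison of the distance with the frozen norm -/

section ChartEstimates

open Filter

variable {E : Type*} [NormedAddCommGroup E] [NormedSpace ℝ E]
  {H : Type*} [TopologicalSpace H] {I : ModelWithCorners ℝ E H}
  {M : Type*} [MetricSpace M] [ChartedSpace H M] [IsManifold I ∞ M]
  [RiemannianBundle (fun x : M => TangentSpace I x)]

variable (I) in
/-- Quantitative control of the Riemannian metric and of the distance on the set `U` in the chart
at `x₀`. -/
structure ChartEstimates (x₀ : M) (C : ℝ) (U : Set M) : Prop where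
  subset_source : U ⊆ (chartAt H x₀).source
  norm_chartVec_le : ∀ u ∈ U, ∀ w, ‖chartVec I x₀ u w‖ ≤ C * ‖w‖
  le_norm_chartVec : ∀ u ∈ U, ∀ w, ‖w‖ ≤ C * ‖chartVec I x₀ u w‖
  norm_sub_le : ∀ u ∈ U, ∀ v ∈ U, ‖extChartAt I x₀ v - extChartAt I x₀ u‖ ≤ C * dist u v
  dist_le : ∀ u ∈ U, ∀ v ∈ U, dist u v ≤ C * ‖extChartAt I x₀ v - extChartAt I x₀ u‖
  abs_norm_chartVec_sub_le : ∀ u ∈ U, ∀ v ∈ U, ∀ w,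
    |‖chartVec I x₀ u w‖ - ‖chartVec I x₀ v w‖| ≤ C * dist u v * ‖w‖
  abs_dist_sub_le : ∀ u ∈ U, ∀ v ∈ U,
    |dist u v - ‖chartVec I x₀ u (extChartAt I x₀ v - extChartAt I x₀ u)‖| ≤ C * dist u v ^ 2

variable [IsContMDiffRiemannianBundle I ∞ E (fun x : M => TangentSpace I x)]

/-- The norm varies in a Lipschitz way, so over a region of size d it differs from the norm frozen
at u by a relative error O(d). The chart segment from u to v bounds the distance from above, and the
frozen length of almost minimal paths bounds it from below; both errors are O(d²). -/
theorem exists_chartEstimates [I.Boundaryless] [IsRiemannianManifold I M] (x₀ : M) :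
    ∃ C > 0, ∃ U ∈ 𝓝 x₀, ChartEstimates I x₀ C U := by
  obtain ⟨C₁, hC₁, h₁⟩ := eventually_norm_chartCoord_le (I := I) x₀
  obtain ⟨C₂, hC₂, h₂⟩ := eventually_norm_chartVec_le (I := I) x₀
  obtain ⟨C₃, hC₃, U₃, hU₃, h₃⟩ := eventually_abs_norm_chartVec_sub_le (I := I) x₀
  obtain ⟨R₀, hR₀, hball⟩ := Metric.mem_nhds_iff.1
    (inter_mem (inter_mem h₁ h₂) (inter_mem hU₃ (chart_source_mem_nhds H x₀)))
  have hsrc : ball x₀ R₀ ⊆ (chartAt H x₀).source := fun q hq => (hball hq).2.2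
  have hcoord : ∀ q ∈ ball x₀ R₀, ∀ v, ‖chartCoord I x₀ q v‖ ≤ C₁ * ‖v‖ :=
    fun q hq => (hball hq).1.1
  have hvec : ∀ q ∈ ball x₀ R₀, ∀ w, ‖chartVec I x₀ q w‖ ≤ C₂ * ‖w‖ :=
    fun q hq => (hball hq).1.2
  have hlip := fun u (hu : u ∈ ball x₀ R₀) v (hv : v ∈ ball x₀ R₀) =>
    h₃ u (hball hu).2.1 v (hball hv).2.1
  obtain ⟨s, hs, hst⟩ : ∃ s > 0, ball (extChartAt I x₀ x₀) s ⊆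
      (extChartAt I x₀).target ∩ (extChartAt I x₀).symm ⁻¹' (ball x₀ R₀) := by
    refine Metric.mem_nhds_iff.1 (inter_mem (extChartAt_target_mem_nhds x₀) ?_)
    refine (continuousAt_extChartAt_symm (I := I) x₀).preimage_mem_nhds ?_
    rw [extChartAt_to_inv]
    exact ball_mem_nhds _ hR₀
  obtain ⟨R₁, hR₁, hR₁s⟩ := Metric.mem_nhds_iff.1
    ((continuousAt_extChartAt (I := I) x₀).preimage_mem_nhds (ball_mem_nhds _ hs))
  -- Points of the R-ball are less than 2R apart, and the lower bound uses balls of twice that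
  -- distance: R + 4R ≤ R₀.
  set R := min (R₀ / 5) R₁ with hR
  have hR0 : 0 < R := by positivity
  have hRR₀ : 5 * R ≤ R₀ := by linarith [min_le_left (R₀ / 5) R₁]
  have hsub : ball x₀ R ⊆ ball x₀ R₀ := ball_subset_ball (by linarith)
  have hsub4 : ∀ u ∈ ball x₀ R, ball u (4 * R) ⊆ ball x₀ R₀ := fun u hu =>
    ball_subset_ball' (by rw [mem_ball] at hu; linarith)
  have hd : ∀ u ∈ ball x₀ R, ∀ v ∈ ball x₀ R, dist u v < 2 * R := fun u hu v hv => by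
    rw [mem_ball] at hu hv
    linarith [dist_triangle_right u v x₀]
  have hnorm : ∀ u ∈ ball x₀ R, ∀ q ∈ ball u (4 * R),
      ‖extChartAt I x₀ q - extChartAt I x₀ u‖ ≤ C₁ * dist u q := by
    intro u hu q hq
    exact norm_map_extChartAt_sub_le (I := I) (ContinuousLinearMap.id ℝ E) hC₁.le ((hsub4 u hu).trans hsrc)
      (fun q hq v => hcoord q (hsub4 u hu hq) v) (by rwa [mem_ball'] at hq)
  have hnorm' : ∀ u ∈ ball x₀ R, ∀ v ∈ ball x₀ R,
      ‖extChartAt I x₀ v - extChartAt I x₀ u‖ ≤ C₁ * dist u v := fun u hu v hv =>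
    hnorm u hu v (by rw [mem_ball']; linarith [hd u hu v hv])
  have hseg : ∀ u ∈ ball x₀ R, ∀ v ∈ ball x₀ R,
      segment ℝ (extChartAt I x₀ u) (extChartAt I x₀ v) ⊆
      (extChartAt I x₀).target ∩ (extChartAt I x₀).symm ⁻¹' (ball x₀ R₀) := fun u hu v hv =>
    ((convex_ball _ _).segment_subset (hR₁s (ball_subset_ball (min_le_right _ _) hu))
      (hR₁s (ball_subset_ball (min_le_right _ _) hv))).trans hst
  have hdist : ∀ u ∈ ball x₀ R, ∀ v ∈ ball x₀ R,
      dist u v ≤ C₂ * ‖extChartAt I x₀ v - extChartAt I x₀ u‖ := fun u hu v hv =>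
    dist_symm_extChartAt_le (I := I) (by positivity) (hsrc (hsub hu)) (hsrc (hsub hv))
      ((hseg u hu v hv).trans inter_subset_left)
      fun p hp => hvec _ (hseg u hu v hv hp).2 _
  have hupper : ∀ u ∈ ball x₀ R, ∀ v ∈ ball x₀ R,
      dist u v ≤ ‖chartVec I x₀ u (extChartAt I x₀ v - extChartAt I x₀ u)‖ +
        C₃ * C₁ ^ 2 * dist u v ^ 2 := by
    intro u hu v hv
    refine dist_symm_extChartAt_le (I := I) (x₀ := x₀) (by positivity) (hsrc (hsub hu)) (hsrc (hsub hv))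
      ((hseg u hu v hv).trans inter_subset_left) fun p hp => ?_
    obtain ⟨hpt, hps⟩ := hseg u hu v hv hp
    have h4 := hlip _ hps u (hsub hu) (extChartAt I x₀ v - extChartAt I x₀ u)
    rw [(extChartAt I x₀).right_inv hpt] at h4
    have h5 := (abs_le.1 h4).2
    have h6 := hnorm' u hu v hv
    have h7 := norm_sub_le_of_mem_segment hp
    have h8 : C₃ * ‖p - extChartAt I x₀ u‖ * ‖extChartAt I x₀ v - extChartAt I x₀ u‖ ≤
        C₃ * (C₁ * dist u v) * (C₁ * dist u v) := by
      gcongr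
      exact h7.trans h6
    linarith
  have hlower : ∀ u ∈ ball x₀ R, ∀ v ∈ ball x₀ R,
      ‖chartVec I x₀ u (extChartAt I x₀ v - extChartAt I x₀ u)‖ ≤
        dist u v + 2 * (C₃ * C₁ ^ 2) * dist u v ^ 2 := by
    intro u hu v hv
    rcases eq_or_ne u v with rfl | huv
    · simp
    have hpos : 0 < dist u v := dist_pos.2 huv
    have h2d : ball u (2 * dist u v) ⊆ ball u (4 * R) :=
      ball_subset_ball (by linarith [hd u hu v hv])
    -- The linear map is the one defining the norm at u, so path lengths are measured in the frozen
    -- norm.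
    have h4 := norm_map_extChartAt_sub_le (I := I) (chartVec I x₀ u) (x₀ := x₀) (a := u) (b := v)
      (R := 2 * dist u v) (K := 1 + C₃ * C₁ ^ 2 * (2 * dist u v)) (by positivity)
      ((h2d.trans (hsub4 u hu)).trans hsrc) (fun q hq v' => ?_) (by linarith)
    · rw [← map_sub] at h4
      linarith
    · have hq0 := hsub4 u hu (h2d hq)
      have h5 := hlip u (hsub hu) q hq0 (chartCoord I x₀ q v')
      rw [chartVec_chartCoord (hsrc hq0)] at h5
      have h6 := hnorm u hu q (h2d hq)
      rw [norm_sub_rev] at h6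
      rw [mem_ball'] at hq
      have h7 : C₃ * ‖extChartAt I x₀ u - extChartAt I x₀ q‖ * ‖chartCoord I x₀ q v'‖ ≤
          C₃ * (C₁ * (2 * dist u v)) * (C₁ * ‖v'‖) := by
        gcongr
        · exact h6.trans (by gcongr)
        · exact hcoord q hq0 v'
      have h8 := (abs_le.1 h5).2
      linarith
  set C := C₁ + C₂ + C₃ * C₁ + 2 * (C₃ * C₁ ^ 2) with hC
  have hCC₁ : C₁ ≤ C := by rw [hC]; linarith [mul_pos hC₃ hC₁, mul_pos hC₃ (pow_pos hC₁ 2)]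
  have hCC₂ : C₂ ≤ C := by rw [hC]; linarith [mul_pos hC₃ hC₁, mul_pos hC₃ (pow_pos hC₁ 2)]
  have hCC₃ : C₃ * C₁ ≤ C := by rw [hC]; linarith [mul_pos hC₃ (pow_pos hC₁ 2)]
  have hCC₄ : 2 * (C₃ * C₁ ^ 2) ≤ C := by rw [hC]; linarith [mul_pos hC₃ hC₁]
  have hC0 : 0 < C := hC₁.trans_le hCC₁
  refine ⟨C, hC0, ball x₀ R, ball_mem_nhds _ hR0, hsub.trans hsrc, ?_, ?_, ?_, ?_, ?_, ?_⟩
  · exact fun u hu w => (hvec u (hsub hu) w).trans (by gcongr)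
  · intro u hu w
    have := hcoord u (hsub hu) (chartVec I x₀ u w)
    rw [chartCoord_chartVec (hsrc (hsub hu))] at this
    exact this.trans (by gcongr)
  · exact fun u hu v hv => (hnorm' u hu v hv).trans (by gcongr)
  · exact fun u hu v hv => (hdist u hu v hv).trans (by gcongr)
  · intro u hu v hv w
    refine (hlip u (hsub hu) v (hsub hv) w).trans ?_
    have := hnorm' u hu v hv
    rw [norm_sub_rev] at this
    calc _ ≤ C₃ * (C₁ * dist u v) * ‖w‖ := by gcongr
      _ = C₃ * C₁ * dist u v * ‖w‖ := by ring
      _ ≤ _ := by gcongr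
  · intro u hu v hv
    have h4 := hupper u hu v hv
    have h5 := hlower u hu v hv
    have h6 : 2 * (C₃ * C₁ ^ 2) * dist u v ^ 2 ≤ C * dist u v ^ 2 := by gcongr
    have h7 : 0 ≤ C₃ * C₁ ^ 2 * dist u v ^ 2 := by positivity
    rw [abs_le]
    constructor <;> linarith

end ChartEstimates

/-! ### Almost extending segments on a compact manifold -/

section Extension

open Filter

/-- A scale for a monotone local property can be chosen uniformly on a compact space. -/
lemma exists_uniform_scale {X : Type*} [PseudoMetricSpace X] [CompactSpace X] {P : X → ℝ → Prop}
    (hmono : ∀ x R R', 0 < R' → R' ≤ R → P x R → P x R')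
    (hloc : ∀ x₀, ∃ R > 0, ∀ x ∈ ball x₀ R, P x R) : ∃ R > 0, ∀ x, P x R := by
  have h : ∃ R > 0, ∀ x ∈ (univ : Set X), P x R := by
    refine isCompact_univ.induction_on (p := fun s => ∃ R > 0, ∀ x ∈ s, P x R) ?_ ?_ ?_ ?_
    · exact ⟨1, one_pos, by simp⟩
    · rintro s t hst ⟨R, hR, h⟩
      exact ⟨R, hR, fun x hx => h x (hst hx)⟩
    · rintro s t ⟨R, hR, h⟩ ⟨R', hR', h'⟩
      have hpos : 0 < min R R' := lt_min hR hR'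
      refine ⟨min R R', hpos, ?_⟩
      rintro x (hx | hx)
      exacts [hmono x _ _ hpos (min_le_left _ _) (h x hx),
        hmono x _ _ hpos (min_le_right _ _) (h' x hx)]
    · intro x _
      obtain ⟨R, hR, h⟩ := hloc x
      exact ⟨_, mem_nhdsWithin_of_mem_nhds (ball_mem_nhds x hR), R, hR, h⟩
  simpa using h

variable {E : Type*} [NormedAddCommGroup E] [NormedSpace ℝ E]
  {H : Type*} [TopologicalSpace H] {I : ModelWithCorners ℝ E H}
  {M : Type*} [MetricSpace M] [ChartedSpace H M] [IsManifold I ∞ M]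
  [RiemannianBundle (fun x : M => TangentSpace I x)]

/-- The norm at `x₀` of the difference in the chart at `x₀` approximates the distance. -/
lemma ChartEstimates.exists_abs_sub_le {x₀ : M} {C : ℝ} {U : Set M} (hC : 0 < C)
    (hU : U ∈ 𝓝 x₀) (h : ChartEstimates I x₀ C U) {ε : ℝ} (hε : 0 < ε) :
    ∃ R > 0, ball x₀ R ⊆ U ∧ ∀ u ∈ ball x₀ R, ∀ v ∈ ball x₀ R,
      |dist u v - ‖chartVec I x₀ x₀ (extChartAt I x₀ v - extChartAt I x₀ u)‖| ≤
        ε * dist u v := by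
  obtain ⟨R₁, hR₁, hRU⟩ := Metric.mem_nhds_iff.1 hU
  set R := min R₁ (ε / (2 * C + C ^ 2)) with hR
  have hR0 : 0 < R := by positivity
  have hRU' : ball x₀ R ⊆ U := (ball_subset_ball (min_le_left _ _)).trans hRU
  have hRε : R * (2 * C + C ^ 2) ≤ ε := by
    rw [← le_div_iff₀ (by positivity)]
    exact min_le_right _ _
  refine ⟨R, hR0, hRU', fun u hu v hv => ?_⟩
  have h1 := h.abs_dist_sub_le u (hRU' hu) v (hRU' hv)
  have h2 := h.abs_norm_chartVec_sub_le u (hRU' hu) x₀ (mem_of_mem_nhds hU)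
    (extChartAt I x₀ v - extChartAt I x₀ u)
  have h3 := h.norm_sub_le u (hRU' hu) v (hRU' hv)
  rw [mem_ball] at hu hv
  have hd : dist u v ≤ 2 * R := by linarith [dist_triangle_right u v x₀]
  have h4 : C * dist u v ^ 2 ≤ C * (2 * R) * dist u v := by
    rw [pow_two, mul_assoc C, ← mul_assoc]
    rw [mul_assoc C]
    gcongr
  have h5 : C * dist u x₀ * ‖extChartAt I x₀ v - extChartAt I x₀ u‖ ≤
      C * R * (C * dist u v) := by gcongr
  have h6 : R * (2 * C + C ^ 2) * dist u v ≤ ε * dist u v := by gcongr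
  calc _ ≤ |dist u v - ‖chartVec I x₀ u (extChartAt I x₀ v - extChartAt I x₀ u)‖| +
        |‖chartVec I x₀ u (extChartAt I x₀ v - extChartAt I x₀ u)‖ -
          ‖chartVec I x₀ x₀ (extChartAt I x₀ v - extChartAt I x₀ u)‖| := abs_sub_le _ _ _
    _ ≤ _ := by linarith

/-- Prolonging x in its own direction makes the norm additive; for x = 0 any direction works, which
needs a nontrivial space. -/
lemma exists_unit_direction {E F : Type*} [AddCommGroup E] [Module ℝ E] [Nontrivial E]
    [NormedAddCommGroup F] [NormedSpace ℝ F] (L : E →ₗ[ℝ] F) (hL : ∀ w, L w = 0 → w = 0) (x : E) :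
    ∃ e : E, ‖L e‖ = 1 ∧ ∀ t : ℝ, 0 ≤ t → ‖L (x + t • e)‖ = ‖L x‖ + t := by
  rcases eq_or_ne x 0 with rfl | hx
  · obtain ⟨e, he⟩ := exists_ne (0 : E)
    have hLe : ‖L e‖ ≠ 0 := fun h => he (hL e (norm_eq_zero.1 h))
    have h1 : ‖L (‖L e‖⁻¹ • e)‖ = 1 := by
      rw [map_smul, norm_smul, norm_inv, norm_norm, inv_mul_cancel₀ hLe]
    refine ⟨‖L e‖⁻¹ • e, h1, fun t ht => ?_⟩
    rw [zero_add, map_smul, norm_smul, h1, map_zero, norm_zero, Real.norm_of_nonneg ht]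
    ring
  · have hLx : ‖L x‖ ≠ 0 := fun h => hx (hL x (norm_eq_zero.1 h))
    refine ⟨‖L x‖⁻¹ • x, ?_, fun t ht => ?_⟩
    · rw [map_smul, norm_smul, norm_inv, norm_norm, inv_mul_cancel₀ hLx]
    · have : x + t • ‖L x‖⁻¹ • x = (1 + t * ‖L x‖⁻¹) • x := by
        rw [add_smul, one_smul, mul_smul]
      rw [this, map_smul, norm_smul, Real.norm_of_nonneg (by positivity)]
      field_simp

variable [IsContMDiffRiemannianBundle I ∞ E (fun x : M => TangentSpace I x)]

-- Near x₀ the distance is, up to a relative error ε, a fixed norm in the chart, where straight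
-- lines extend. No geodesics are needed, and compactness makes the scale uniform.
variable (I M) in
theorem almostExtendsSegments [I.Boundaryless] [IsRiemannianManifold I M] [CompactSpace M]
    [Nontrivial E] : AlmostExtendsSegments M := by
  intro δ hδ
  obtain ⟨ε, hε, hε1, hεδ⟩ : ∃ ε : ℝ, 0 < ε ∧ ε < 1 ∧ 2 * ε ≤ δ :=
    ⟨min δ 1 / 2, by positivity, by linarith [min_le_right δ 1], by linarith [min_le_left δ 1]⟩
  refine exists_uniform_scale (P := fun x R => ∀ (p : M) (s : ℝ), dist x p ≤ R → 0 ≤ s → s ≤ R →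
    ∃ w, dist x w ≤ s ∧ (1 - δ) * (dist x p + s) ≤ dist w p)
    (fun x R R' _ hR h p s h1 h2 h3 => h p s (h1.trans hR) h2 (h3.trans hR)) fun x₀ => ?_
  obtain ⟨C, hC, U, hU, hest⟩ := exists_chartEstimates (I := I) x₀
  obtain ⟨R₁, hR₁, hR₁U, happ⟩ := hest.exists_abs_sub_le hC hU hε
  obtain ⟨s₁, hs₁, hst⟩ : ∃ s > 0, ball (extChartAt I x₀ x₀) s ⊆
      (extChartAt I x₀).target ∩ (extChartAt I x₀).symm ⁻¹' (ball x₀ R₁) := by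
    refine Metric.mem_nhds_iff.1 (inter_mem (extChartAt_target_mem_nhds x₀) ?_)
    refine (continuousAt_extChartAt_symm (I := I) x₀).preimage_mem_nhds ?_
    rw [extChartAt_to_inv]
    exact ball_mem_nhds _ hR₁
  set R := min (R₁ / 2) (s₁ / (4 * C)) with hR
  have hR0 : 0 < R := by positivity
  have hRR₁ : 2 * R ≤ R₁ := by linarith [min_le_left (R₁ / 2) (s₁ / (4 * C))]
  have hRs₁ : R * (4 * C) ≤ s₁ := by
    rw [← le_div_iff₀ (by positivity)]
    exact min_le_right _ _
  have hx₀U : x₀ ∈ U := mem_of_mem_nhds hU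
  refine ⟨R, hR0, fun x hx p s hxp hs hsR => ?_⟩
  rw [mem_ball'] at hx
  have hx1 : x ∈ ball x₀ R₁ := by rw [mem_ball']; linarith
  have hp1 : p ∈ ball x₀ R₁ := by
    rw [mem_ball']
    linarith [dist_triangle x₀ x p]
  set φ := extChartAt I x₀ with hφ
  have hinj : ∀ w, chartVec I x₀ x₀ w = 0 → w = 0 := fun w hw => by
    have := hest.le_norm_chartVec x₀ hx₀U w
    rw [hw, norm_zero, mul_zero] at this
    exact norm_le_zero_iff.1 this
  obtain ⟨e, he, headd⟩ := exists_unit_direction (chartVec I x₀ x₀).toLinearMap hinj (φ x - φ p)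
  have heC : ‖e‖ ≤ C := by
    have := hest.le_norm_chartVec x₀ hx₀U e
    rwa [show ‖chartVec I x₀ x₀ e‖ = 1 from he, mul_one] at this
  -- The shortening compensates for the relative error, so that the true distance from x to w is
  -- still at most s.
  set t := s * (1 - ε) with ht
  have ht0 : 0 ≤ t := mul_nonneg hs (by linarith)
  have hts : t ≤ s := by rw [ht]; nlinarith
  have hmem : φ x + t • e ∈ ball (φ x₀) s₁ := by
    have h1 := hest.norm_sub_le x₀ hx₀U x (hR₁U hx1)
    have h2 : ‖t • e‖ ≤ R * C := by
      rw [norm_smul, Real.norm_of_nonneg ht0]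
      have := hts.trans hsR
      gcongr
    have h3 : ‖φ x - φ x₀‖ ≤ C * R := h1.trans (by gcongr)
    rw [mem_ball, dist_eq_norm, add_sub_right_comm]
    have := norm_add_le (φ x - φ x₀) (t • e)
    have h4 : 0 < R * C := by positivity
    linarith
  obtain ⟨hmt, hmR⟩ := hst hmem
  set w := φ.symm (φ x + t • e) with hw
  have hφw : φ w = φ x + t • e := φ.right_inv hmt
  have hw1 : w ∈ ball x₀ R₁ := hmR
  have h1 := happ x hx1 w hw1
  have h2 := happ p hp1 w hw1
  have h3 := happ p hp1 x hx1
  have e1 : ‖chartVec I x₀ x₀ (φ w - φ x)‖ = t := by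
    rw [hφw, add_sub_cancel_left, map_smul, norm_smul, Real.norm_of_nonneg ht0,
      show ‖chartVec I x₀ x₀ e‖ = 1 from he, mul_one]
  have e2 : ‖chartVec I x₀ x₀ (φ w - φ p)‖ = ‖chartVec I x₀ x₀ (φ x - φ p)‖ + t := by
    rw [hφw, add_sub_right_comm]
    exact headd t ht0
  rw [e1, abs_le] at h1
  rw [e2, abs_le, dist_comm p w] at h2
  rw [abs_le, dist_comm p x] at h3
  refine ⟨w, ?_, ?_⟩
  · have : (1 - ε) * dist x w ≤ (1 - ε) * s := by linarith
    exact le_of_mul_le_mul_left this (by linarith)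
  · have h4 : (1 - ε) * (dist x p + s) ≤ (1 + ε) * dist w p := by linarith
    have h5 : 0 ≤ dist x p + s := by positivity
    have h6 : (1 + ε) * ((1 - δ) * (dist x p + s)) ≤ (1 - ε) * (dist x p + s) := by
      have : (1 + ε) * (1 - δ) ≤ 1 - ε := by nlinarith
      rw [← mul_assoc]
      gcongr
    exact le_of_mul_le_mul_left (h6.trans h4) (by linarith)

end Extension

/-! ### Conformal C^(1+θ) maps are infinitesimal similarities -/

section Similarity

open Filter

variable {E : Type*} [NormedAddCommGroup E] [NormedSpace ℝ E]
  {H : Type*} [TopologicalSpace H] {I : ModelWithCorners ℝ E H}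
  {M : Type*} [MetricSpace M] [ChartedSpace H M]

/-- Conformal factors multiply exactly in the chain rule; this turns the expansion hypothesis into a
lower bound for `iterFactor`. -/
lemma norm_mfderiv_iterate [RiemannianBundle (fun x : M => TangentSpace I x)] {f : M → M}
    (hf : MDifferentiable I I f) {a : M → ℝ}
    (ha : ∀ (x : M) (v : TangentSpace I x), ‖mfderiv I I f x v‖ = a x * ‖v‖) (k : ℕ) (x : M)
    (v : TangentSpace I x) : ‖mfderiv I I (f^[k]) x v‖ = iterFactor f a k x * ‖v‖ := by
  have hk : ∀ k, MDifferentiable I I (f^[k]) := fun k => by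
    induction k with
    | zero => exact mdifferentiable_id
    | succ k ih =>
      rw [Function.iterate_succ']
      exact hf.comp ih
  induction k with
  | zero =>
    rw [Function.iterate_zero, mfderiv_id, iterFactor_zero, one_mul]
    rfl
  | succ k ih =>
    rw [Function.iterate_succ', mfderiv_comp x (hf _) (hk k x), iterFactor_succ]
    refine (ha _ _).trans ?_
    exact (congrArg (a (f^[k] x) * ·) ih).trans (by ring)

variable [IsManifold I ∞ M]

lemma hasFDerivAt_writtenInExtChartAt [I.Boundaryless] {f : M → M} {x₀ u : M}
    (hf : MDifferentiableAt I I f u) (hu : u ∈ (chartAt H x₀).source)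
    (hfu : f u ∈ (chartAt H (f x₀)).source) :
    HasFDerivAt (writtenInExtChartAt I I x₀ f)
      ((chartCoord I (f x₀) (f u)).comp ((mfderiv I I f u).comp (chartVec I x₀ u)))
      (extChartAt I x₀ u) := by
  have hu' : u ∈ (extChartAt I x₀).source := by rwa [extChartAt_source]
  have hinv := (extChartAt I x₀).left_inv hu'
  have h1 := hasMFDerivAt_extChartAt_symm_chartVec (I := I) ((extChartAt I x₀).map_source hu')
  rw [hinv] at h1
  have h2 : HasMFDerivAt I I f ((extChartAt I x₀).symm (extChartAt I x₀ u)) (mfderiv I I f u) := by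
    rw [hinv]
    exact hf.hasMFDerivAt
  have h3 : HasMFDerivAt I 𝓘(ℝ, E) (extChartAt I (f x₀))
      ((f ∘ (extChartAt I x₀).symm) (extChartAt I x₀ u)) (chartCoord I (f x₀) (f u)) := by
    rw [Function.comp_apply, hinv]
    exact hasMFDerivAt_extChartAt_chartCoord hfu
  exact (HasMFDerivAt.comp _ h3 (HasMFDerivAt.comp _ h2 h1)).hasFDerivAt

variable [RiemannianBundle (fun x : M => TangentSpace I x)]

variable [IsContMDiffRiemannianBundle I ∞ E (fun x : M => TangentSpace I x)]

/-- Three approximations: d(f u, f v) by the norm at f u of the chart difference, that difference by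
the derivative at u applied to the difference of u and v (Taylor with Hölder remainder), and the
norm at u by d(u, v). Conformality links the last two exactly. Using R⁻¹ as the constant leaves a
single parameter, and decreasing it weakens the claim, as `exists_uniform_scale` requires. -/
lemma exists_local_similarity_estimate [I.Boundaryless] [IsRiemannianManifold I M] [Nontrivial E]
    {f : M → M} (hf : MDifferentiable I I f) {θ : ℝ≥0} (hθ1 : θ ≤ 1) {a : M → ℝ}
    (ha0 : ∀ x, 0 ≤ a x)
    (ha : ∀ (x : M) (v : TangentSpace I x), ‖mfderiv I I f x v‖ = a x * ‖v‖) {x₀ : M} {Ch : ℝ≥0}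
    {N : Set E} (hN : N ∈ 𝓝 (extChartAt I x₀ x₀))
    (hH : HolderOnWith Ch θ (fderiv ℝ (writtenInExtChartAt I I x₀ f)) N) :
    ∃ R > 0, ∀ u ∈ ball x₀ R, ∀ v, dist u v ≤ R →
      |dist (f u) (f v) - a u * dist u v| ≤ R⁻¹ * dist u v ^ (1 + θ : ℝ) := by
  obtain ⟨C, hC, U, hU, hest⟩ := exists_chartEstimates (I := I) x₀
  obtain ⟨C', hC', U', hU', hest'⟩ := exists_chartEstimates (I := I) (f x₀)
  set φ := extChartAt I x₀ with hφ
  set ψ := extChartAt I (f x₀) with hψ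
  set F := writtenInExtChartAt I I x₀ f with hF
  have hsymm : ContinuousAt φ.symm (φ x₀) := continuousAt_extChartAt_symm (I := I) x₀
  have hsymm' : φ.symm (φ x₀) = x₀ := extChartAt_to_inv x₀
  have hUf : U ∩ f ⁻¹' U' ∈ 𝓝 x₀ :=
    inter_mem hU ((hf x₀).continuousAt.preimage_mem_nhds hU')
  obtain ⟨s, hs, hst⟩ : ∃ s > 0, ball (φ x₀) s ⊆
      (φ.target ∩ N) ∩ φ.symm ⁻¹' (U ∩ f ⁻¹' U') := by
    refine Metric.mem_nhds_iff.1 (inter_mem (inter_mem (extChartAt_target_mem_nhds x₀) hN) ?_)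
    refine hsymm.preimage_mem_nhds ?_
    rwa [hsymm']
  have hsx₀ : φ x₀ ∈ ball (φ x₀) s := mem_ball_self hs
  obtain ⟨R₁, hR₁, hR₁s⟩ := Metric.mem_nhds_iff.1 (inter_mem hUf
    ((continuousAt_extChartAt (I := I) x₀).preimage_mem_nhds (ball_mem_nhds _ hs)))
  have hsub : ∀ u ∈ ball x₀ R₁, u ∈ U ∧ f u ∈ U' ∧ φ u ∈ ball (φ x₀) s := fun u hu =>
    ⟨(hR₁s hu).1.1, (hR₁s hu).1.2, (hR₁s hu).2⟩
  have hdiff : ∀ p ∈ ball (φ x₀) s, HasFDerivAt F (fderiv ℝ F p) p := by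
    intro p hp
    obtain ⟨⟨hpt, -⟩, hpU, hpU'⟩ := hst hp
    have := hasFDerivAt_writtenInExtChartAt (hf (φ.symm p)) (hest.subset_source hpU)
      (hest'.subset_source hpU')
    rw [φ.right_inv hpt] at this
    exact this.differentiableAt.hasFDerivAt
  have hFu : ∀ u ∈ ball x₀ R₁, F (φ u) = ψ (f u) := by
    intro u hu
    have hus : u ∈ φ.source := by
      rw [hφ, extChartAt_source]
      exact hest.subset_source (hsub u hu).1
    simp only [hF, writtenInExtChartAt, Function.comp_apply]
    rw [← hφ, φ.left_inv hus]
  have hDF : ∀ u ∈ ball x₀ R₁, ∀ w, ‖chartVec I (f x₀) (f u) (fderiv ℝ F (φ u) w)‖ =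
      a u * ‖chartVec I x₀ u w‖ := by
    intro u hu w
    obtain ⟨huU, hfU, -⟩ := hsub u hu
    have h1 := (hasFDerivAt_writtenInExtChartAt (hf u) (hest.subset_source huU)
      (hest'.subset_source hfU)).fderiv
    have h2 : fderiv ℝ F (φ u) w =
        chartCoord I (f x₀) (f u) (mfderiv I I f u (chartVec I x₀ u w)) := by rw [h1]; rfl
    rw [h2, chartVec_chartCoord (hest'.subset_source hfU)]
    exact ha _ _
  -- bounds for the derivative in the chart
  have hhol : ∀ p ∈ ball (φ x₀) s, ∀ q ∈ ball (φ x₀) s,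
      ‖fderiv ℝ F q - fderiv ℝ F p‖ ≤ Ch * ‖q - p‖ ^ (θ : ℝ) := by
    intro p hp q hq
    have := hH.dist_le (hst hq).1.2 (hst hp).1.2
    rwa [dist_eq_norm, dist_eq_norm] at this
  set B := ‖fderiv ℝ F (φ x₀)‖ + Ch * s ^ (θ : ℝ) with hB
  have hB0 : 0 ≤ B := by positivity
  have hDB : ∀ p ∈ ball (φ x₀) s, ‖fderiv ℝ F p‖ ≤ B := by
    intro p hp
    have h1 := hhol _ hsx₀ p hp
    rw [mem_ball, dist_eq_norm] at hp
    have h2 : Ch * ‖p - φ x₀‖ ^ (θ : ℝ) ≤ Ch * s ^ (θ : ℝ) := by gcongr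
    have h3 := norm_add_le (fderiv ℝ F (φ x₀)) (fderiv ℝ F p - fderiv ℝ F (φ x₀))
    rw [add_sub_cancel] at h3
    linarith
  have hseg : ∀ p ∈ ball (φ x₀) s, ∀ q ∈ ball (φ x₀) s, segment ℝ p q ⊆ ball (φ x₀) s :=
    fun p hp q hq => (convex_ball _ _).segment_subset hp hq
  have hlipF : ∀ p ∈ ball (φ x₀) s, ∀ q ∈ ball (φ x₀) s, ‖F q - F p‖ ≤ B * ‖q - p‖ :=
    fun p hp q hq => (convex_ball _ _).norm_image_sub_le_of_norm_hasFDerivWithin_le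
      (fun z hz => (hdiff z hz).hasFDerivWithinAt) hDB hp hq
  have htaylor : ∀ p ∈ ball (φ x₀) s, ∀ q ∈ ball (φ x₀) s,
      ‖F q - F p - fderiv ℝ F p (q - p)‖ ≤ Ch * ‖q - p‖ ^ (θ : ℝ) * ‖q - p‖ := by
    intro p hp q hq
    -- The mean value inequality is applied on the segment, where ‖z - p‖ ≤ ‖q - p‖, rather than on
    -- the whole ball.
    refine (convex_segment p q).norm_image_sub_le_of_norm_hasFDerivWithin_le'
      (fun z hz => (hdiff z (hseg p hp q hq hz)).hasFDerivWithinAt) (fun z hz => ?_)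
      (left_mem_segment ℝ p q) (right_mem_segment ℝ p q)
    refine (hhol p hp z (hseg p hp q hq hz)).trans ?_
    gcongr
    exact norm_sub_le_of_mem_segment hz
  have haB : ∀ u ∈ ball x₀ R₁, a u ≤ C' * B * C := by
    intro u hu
    obtain ⟨huU, hfU, hus⟩ := hsub u hu
    obtain ⟨w, hw⟩ := exists_ne (0 : E)
    have h1 := hest.le_norm_chartVec u huU w
    have hwpos : 0 < ‖chartVec I x₀ u w‖ := by
      have := norm_pos_iff.2 hw
      by_contra! h
      nlinarith
    have h2 := hest'.norm_chartVec_le (f u) hfU (fderiv ℝ F (φ u) w)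
    rw [hDF u hu] at h2
    have h3 : ‖fderiv ℝ F (φ u) w‖ ≤ B * (C * ‖chartVec I x₀ u w‖) :=
      ((fderiv ℝ F (φ u)).le_of_opNorm_le (hDB _ hus) w).trans (by gcongr)
    have h4 : a u * ‖chartVec I x₀ u w‖ ≤ C' * B * C * ‖chartVec I x₀ u w‖ := by
      calc _ ≤ C' * (B * (C * ‖chartVec I x₀ u w‖)) := h2.trans (by gcongr)
        _ = _ := by ring
    exact le_of_mul_le_mul_right h4 hwpos
  set K := C' * (C' * (B * C)) ^ 2 + C' * (Ch * C ^ (θ : ℝ) * C) + C' * B * C * C + 1 with hK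
  have hK0 : 0 < K := by positivity
  refine ⟨min (R₁ / 2) (min 1 K⁻¹), by positivity, fun u hu v huv => ?_⟩
  have hRR₁ := min_le_left (R₁ / 2) (min 1 K⁻¹)
  have hR1 : min (R₁ / 2) (min 1 K⁻¹) ≤ 1 := (min_le_right _ _).trans (min_le_left _ _)
  have hRK : min (R₁ / 2) (min 1 K⁻¹) ≤ K⁻¹ := (min_le_right _ _).trans (min_le_right _ _)
  set R := min (R₁ / 2) (min 1 K⁻¹) with hR
  have hR0 : 0 < R := by positivity
  have hu1 : u ∈ ball x₀ R₁ := ball_subset_ball (by linarith) hu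
  have hv1 : v ∈ ball x₀ R₁ := by
    rw [mem_ball] at hu ⊢
    linarith [dist_triangle_left v x₀ u]
  obtain ⟨huU, hfU, hus⟩ := hsub u hu1
  obtain ⟨hvU, hfvU, hvs⟩ := hsub v hv1
  have hd0 : 0 ≤ dist u v := dist_nonneg
  have hpow : dist u v ^ (1 + θ : ℝ) = dist u v * dist u v ^ (θ : ℝ) := by
    rw [Real.rpow_add_of_nonneg hd0 zero_le_one θ.coe_nonneg, Real.rpow_one]
  -- Here θ ≤ 1 enters: it absorbs the quadratic errors of the metric into the Hölder error.
  have hsq : dist u v ^ 2 ≤ dist u v ^ (1 + θ : ℝ) := by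
    rw [hpow, pow_two]
    gcongr
    calc dist u v = dist u v ^ (1 : ℝ) := (Real.rpow_one _).symm
      _ ≤ _ := Real.rpow_le_rpow_of_exponent_ge' hd0 (huv.trans hR1) θ.coe_nonneg hθ1
  have hΔ := hest.norm_sub_le u huU v hvU
  have h1 := hest'.abs_dist_sub_le (f u) hfU (f v) hfvU
  have h2 := hest.abs_dist_sub_le u huU v hvU
  have hdd : dist (f u) (f v) ≤ C' * (B * C) * dist u v := by
    refine (hest'.dist_le (f u) hfU (f v) hfvU).trans ?_
    rw [← hψ, ← hFu u hu1, ← hFu v hv1]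
    calc _ ≤ C' * (B * (C * dist u v)) := by
          gcongr
          exact (hlipF _ hus _ hvs).trans (by gcongr)
      _ = _ := by ring
  have h3 : C' * dist (f u) (f v) ^ 2 ≤ C' * (C' * (B * C)) ^ 2 * dist u v ^ (1 + θ : ℝ) := by
    calc _ ≤ C' * (C' * (B * C) * dist u v) ^ 2 := by gcongr
      _ = C' * (C' * (B * C)) ^ 2 * dist u v ^ 2 := by ring
      _ ≤ _ := by gcongr
  have h4 : |‖chartVec I (f x₀) (f u) (ψ (f v) - ψ (f u))‖ -
      a u * ‖chartVec I x₀ u (φ v - φ u)‖| ≤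
      C' * (Ch * C ^ (θ : ℝ) * C) * dist u v ^ (1 + θ : ℝ) := by
    rw [← hDF u hu1, ← hFu u hu1, ← hFu v hv1]
    refine (abs_norm_sub_norm_le _ _).trans ?_
    rw [← map_sub]
    refine (hest'.norm_chartVec_le (f u) hfU _).trans ?_
    rw [mul_assoc C']
    gcongr
    refine (htaylor _ hus _ hvs).trans ?_
    calc _ ≤ Ch * (C * dist u v) ^ (θ : ℝ) * (C * dist u v) := by gcongr
      _ = _ := by
        rw [Real.mul_rpow hC.le hd0, hpow]
        ring
  have h5 : |a u * ‖chartVec I x₀ u (φ v - φ u)‖ - a u * dist u v| ≤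
      C' * B * C * C * dist u v ^ (1 + θ : ℝ) := by
    rw [← mul_sub, abs_mul, abs_of_nonneg (ha0 u), abs_sub_comm]
    calc _ ≤ (C' * B * C) * (C * dist u v ^ 2) := by
          gcongr
          exact haB u hu1
      _ = C' * B * C * C * dist u v ^ 2 := by ring
      _ ≤ _ := by gcongr
  have h6 : K ≤ R⁻¹ := by
    rw [le_inv_comm₀ hK0 hR0]
    exact hRK
  calc _ ≤ |dist (f u) (f v) - ‖chartVec I (f x₀) (f u) (ψ (f v) - ψ (f u))‖| +
        (|‖chartVec I (f x₀) (f u) (ψ (f v) - ψ (f u))‖ - a u * ‖chartVec I x₀ u (φ v - φ u)‖| +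
        |a u * ‖chartVec I x₀ u (φ v - φ u)‖ - a u * dist u v|) :=
        (abs_sub_le _ _ _).trans (by gcongr; exact abs_sub_le _ _ _)
    _ ≤ K * dist u v ^ (1 + θ : ℝ) := by
        have : 0 ≤ dist u v ^ (1 + θ : ℝ) := by positivity
        rw [hK]
        linarith
    _ ≤ _ := by gcongr

end Similarity

/-! ### The main theorem -/

theorem theorem1p2 {n : ℕ} (hn : 1 ≤ n) {M : Type*} [MetricSpace M] [CompactSpace M]
    [ChartedSpace (EuclideanSpace ℝ (Fin n)) M] [IsManifold (𝓡 n) ∞ M]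
    [RiemannianBundle (fun x : M => TangentSpace (𝓡 n) x)]
    [IsContMDiffRiemannianBundle (𝓡 n) ∞ (EuclideanSpace ℝ (Fin n))
      (fun x : M => TangentSpace (𝓡 n) x)]
    [IsRiemannianManifold (𝓡 n) M]
    (θ : ℝ≥0) (hθ0 : 0 < θ) (hθ1 : θ ≤ 1) (f : M → M)
    (hf : IsC1Holder (n := n) θ f) (hexp : IsExpanding (n := n) f)
    (hconf : IsConformalEndo (n := n) f) (y : M) :
    IsAbsoluteWinning (nonAccumulationSet f y) ∧
      IsSchmidtWinning (1 / 2) (nonAccumulationSet f y) := by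
  -- Positive dimension provides the nonzero tangent vectors from which the factors are read off and
  -- the directions used to move away from a point.
  have : Nonempty (Fin n) := ⟨⟨0, hn⟩⟩
  have : Nontrivial (EuclideanSpace ℝ (Fin n)) := inferInstance
  obtain ⟨hf1, hfH⟩ := hf
  have hfd : MDifferentiable (𝓡 n) (𝓡 n) f := hf1.mdifferentiable one_ne_zero
  obtain ⟨c, hc, σ, hσ, hexp⟩ := hexp
  choose b L hL using hconf
  set a : M → ℝ := fun x => |b x| with ha_def
  have ha0 : ∀ x, 0 ≤ a x := fun x => abs_nonneg _
  have ha : ∀ (x : M) (v : TangentSpace (𝓡 n) x), ‖mfderiv (𝓡 n) (𝓡 n) f x v‖ = a x * ‖v‖ := by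
    intro x v
    rw [hL x v, norm_smul, LinearIsometry.norm_map, Real.norm_eq_abs]
  have hfactor : ∀ k u, c * σ ^ k ≤ iterFactor f a k u := by
    intro k u
    obtain ⟨v, hv⟩ : ∃ v : TangentSpace (𝓡 n) u, v ≠ 0 :=
      exists_ne (0 : EuclideanSpace ℝ (Fin n))
    have h1 := hexp k u v
    rw [norm_mfderiv_iterate hfd ha] at h1
    exact le_of_mul_le_mul_right h1 (norm_pos_iff.2 hv)
  have hapos : ∀ u, 0 < a u := fun u => by
    have := hfactor 1 u
    simp only [iterFactor, Finset.prod_range_one, pow_one, Function.iterate_zero, id_eq] at this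
    exact lt_of_lt_of_le (by positivity) this
  have hlocal : ∃ R > 0, ∀ u, ∀ v, dist u v ≤ R →
      |dist (f u) (f v) - a u * dist u v| ≤ R⁻¹ * dist u v ^ (1 + θ : ℝ) := by
    refine exists_uniform_scale (P := fun u R => ∀ v, dist u v ≤ R →
      |dist (f u) (f v) - a u * dist u v| ≤ R⁻¹ * dist u v ^ (1 + θ : ℝ))
      (fun x R R' hR' hRR' h v hv => (h v (hv.trans hRR')).trans (by gcongr)) fun x₀ => ?_
    obtain ⟨Ch, N, hN, hH⟩ := hfH x₀
    exact exists_local_similarity_estimate hfd hθ1 ha0 ha hN hH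
  obtain ⟨R, hR, hsim⟩ := hlocal
  obtain ⟨κ, hκ, D, hD, hdist⟩ := exists_bounded_distortion hc hσ hapos hfactor
    (NNReal.coe_pos.2 hθ0) hR hsim
  have hX : AlmostExtendsSegments M := almostExtendsSegments (𝓡 n) M
  have hS : HasEscapingChoice (nonAccumulationSet f y) := fun β ρ hβ hβ1 hρ =>
    exists_escaping_choice hf1.continuous hc hσ hfactor hκ hD hdist y hβ hβ1 hρ
  exact ⟨isAbsoluteWinning_of_hasEscapingChoice hX hS,
    isSchmidtWinning_half_of_hasEscapingChoice hX hS⟩
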